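/- **Setting.** FPC is the call-by-name simply typed $\lambda$-calculus with types $\tau ::= \alpha \mid 1 \mid \tau+\tau \mid \tau\times\tau \mid \tau\to\tau \mid \mu\alpha.\tau$ and terms $\langle\rangle$, $x$, $\mathtt{inl}\,M$, $\mathtt{inr}\,M$, $\mathtt{case}\,L\,\mathtt{of}\,x_1.M;\,x_2.N$, $\langle M,N\rangle$, $\mathtt{fst}\,M$, $\mathtt{snd}\,M$, $\lambda x{:}\tau.M$, $M\,N$, $\mathtt{fold}\,M$, $\mathtt{unfold}\,M$, with the usual typing judgement $\Gamma\vdash M:\tau$ ($\Gamma$ and $\tau$ closed types; $\mathtt{unfold}$ and $\mathtt{fold}$ pass between $\mu\alpha.\tau$ and $\tau[\mu\alpha.\tau/\alpha]$). *Operational semantics.* $M\to^k N$ ($k\in\{0,1\}$) is the closure under the evaluation contexts $E ::= [\cdot]\mid E\,M\mid \mathtt{case}\,E\,\mathtt{of}\,x_1.M;\,x_2.N\mid \mathtt{fst}\,E\mid\mathtt{snd}\,E\mid\mathtt{unfold}\,E$ of the $\beta$-rules for functions, sums and products (with $k=0$) and of $\mathtt{unfold}(\mathtt{fold}\,M)\to^1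 M$; and $M\to^k_* N$ means that $M$ reduces to $N$ in finitely many steps whose labels add up to $k$. *Guarded type theory.* Statements are in guarded dependent type theory with a single clock and later modality $\triangleright$, and are interpreted in its standard model, the topos of trees (presheaves on $\omega$, with stages $n=0,1,2,\dots$; $\triangleright X$ is a singleton at stage $0$ and is $X(n)$ at stage $n+1$). The guarded transitive closure $M\Rightarrow^k N$ is the proposition of this theory given by: $M\Rightarrow^0 N$ iff $M\to^0_* N$; and $M\Rightarrow^{k+1}N$ iff there are $M',M''$ with $M\to^0_* M'$, $M'\to^1 M''$ and $\triangleright(M''\Rightarrow^k N)$. *Denotational semantics.* Let $LA\cong A+\triangleright LA$ be the guarded lifting monad, with unit $\eta:A\to LA$ and $\theta:\triangleright LA\to LA$. Types are interpreted, by induction and guarded recursion in the universe, by $[\![1]\!]=L1$, $[\![\sigma\times\tau]\!]=[\![\sigma]\!]\times[\![\tau]\!]$, $[\![\sigma+\tau]\!]=L([\![\sigma]\!]+[\![\tau]\!])$, $[\![\sigma\to\tau]\!]=[\![\sigma]\!]\to[\![\tau]\!]$, and $[\![\mu\alpha.\tau]\!](\rho)=\triangleright\big([\![\tau]\!](\rho,[\![\mu\alpha.\tau]\!](\rho))\big)$,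 so that $[\![\mu\alpha.\tau]\!]=\triangleright[\![\tau[\mu\alpha.\tau/\alpha]]\!]$. Each closed $\tau$ carries $\theta_\tau:\triangleright[\![\tau]\!]\to[\![\tau]\!]$: that of $L$ for $1$ and sums, componentwise for products, pointwise for functions, and $\theta_{\mu\alpha.\tau}=\triangleright(\theta_{\tau[\mu\alpha.\tau/\alpha]})$. A typing derivation of $\Gamma\vdash M:\tau$ denotes a map $[\![M]\!]:[\![\Gamma]\!]\to[\![\tau]\!]$: $[\![\langle\rangle]\!]=\eta(*)$; $\mathtt{inl}$ and $\mathtt{inr}$ are interpreted by $\eta\circ\mathrm{inl}$ and $\eta\circ\mathrm{inr}$; $\mathtt{case}$ by the extension of the two branches to a homomorphism of $\triangleright$-algebras out of $L([\![\tau_1]\!]+[\![\tau_2]\!])$; $\mathtt{fold}$ by $\mathrm{next}$; $\mathtt{unfold}$ by $\theta_{\tau[\mu\alpha.\tau/\alpha]}$; and variables, products and functions in the standard way. *Contexts.* A context $C[-]$ is a term with one hole; filling the hole may capture variables. It has type $(\Gamma,\tau)\to(-,1)$ if $C[P]$ is a closed term of type $1$ whenever $\Gamma\vdash P:\tau$.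 **Statement.** Suppose $\Gamma\vdash M:\tau$ and $\Gamma\vdash N:\tau$, and let $C[-]$ be a context of type $(\Gamma,\tau)\to(-,1)$ and $k$ a natural number. If $[\![M]\!]=[\![N]\!]$ and $C[M]\Rightarrow^k\langle\rangle$, then $C[N]\Rightarrow^k\langle\rangle$. Explicitly, this implication holds at every stage $n$ of the topos of trees: if $[\![M]\!]$ and $[\![N]\!]$ are equal up to stage $n$ and $C[M]\Rightarrow^k\langle\rangle$ holds at stage $n$, then $C[N]\Rightarrow^k\langle\rangle$ holds at stage $n$. -/

import Mathlib

/-!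
  FPC (simply typed lambda calculus with recursive types, call by name), its step-counting
  operational semantics, and its denotational semantics in guarded type theory, the latter
  interpreted in the standard model of guarded type theory: the topos of trees.

  Stages are numbered from 0.  A closed type is a tree `X 0 ← X 1 ← X 2 ← …` of sets, and a
  proposition is a predicate on stages.
-/

namespace FPC

/-! ### The universe of the topos of trees -/

/-- Trees of small sets cut off at height `n`, that is, presheaves on `{0, …, n - 1}`.
`Psh (n + 1)` is the set of elements at stage `n` of the universe `U` of the topos of trees, and
`Psh n` is the set of elements at stage `n` of `▷ U` (`Psh 0` has exactly one element). -/
@[ext]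
structure Psh (n : ℕ) : Type 1 where
  /-- the set at stage `m` -/
  obj : ∀ m, m < n → Type
  /-- the restriction map from stage `m + 1` to stage `m` -/
  res : ∀ (m : ℕ) (h : m + 1 < n), obj (m + 1) h → obj m (Nat.lt_of_succ_lt h)

/-- Natural families of maps. -/
@[ext]
structure Hom {n : ℕ} (X Y : Psh n) : Type where
  app : ∀ (m : ℕ) (h : m < n), X.obj m h → Y.obj m h
  nat : ∀ (m : ℕ) (h : m + 1 < n) (x : X.obj (m + 1) h),
    Y.res m h (app (m + 1) h x) = app m (Nat.lt_of_succ_lt h) (X.res m h x)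

namespace Psh

/-- Restriction of elements of the universe to an earlier stage. -/
def restrict {n k : ℕ} (h : k ≤ n) (X : Psh n) : Psh k where
  obj m hm := X.obj m (Nat.lt_of_lt_of_le hm h)
  res m hm := X.res m (Nat.lt_of_lt_of_le hm h)

/-- Restriction by one stage. -/
abbrev pred {n : ℕ} (X : Psh (n + 1)) : Psh n := X.restrict (Nat.le_succ n)

/-- The composite restriction map from stage `m` to stage `j ≤ m`. -/
def resTo {n : ℕ} (X : Psh n) {j m : ℕ} (hj : j < n) (hjm : j ≤ m) :
    ∀ h : m < n, X.obj m h → X.obj j hj :=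
  Nat.leRecOn (C := fun m => ∀ h : m < n, X.obj m h → X.obj j hj) hjm
    (fun {k} ih h x => ih (Nat.lt_of_succ_lt h) (X.res k h x)) (fun _ x => x)

theorem resTo_self {n : ℕ} (X : Psh n) {j : ℕ} (hj : j < n) (x : X.obj j hj) :
    X.resTo hj le_rfl hj x = x := by
  unfold resTo
  rw [Nat.leRecOn_self]

theorem resTo_succ {n : ℕ} (X : Psh n) {j m : ℕ} (hj : j < n) (hjm : j ≤ m) (h : m + 1 < n)
    (x : X.obj (m + 1) h) :
    X.resTo hj (Nat.le_succ_of_le hjm) h x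
      = X.resTo hj hjm (Nat.lt_of_succ_lt h) (X.res m h x) := by
  unfold resTo
  rw [Nat.leRecOn_succ hjm]

theorem res_resTo {n : ℕ} (X : Psh n) {j m : ℕ} (hj : j + 1 < n) (hjm : j + 1 ≤ m) (h : m < n)
    (x : X.obj m h) :
    X.res j hj (X.resTo hj hjm h x)
      = X.resTo (Nat.lt_of_succ_lt hj) (Nat.le_of_succ_le hjm) h x := by
  induction m, hjm using Nat.le_induction with
  | base => rw [resTo_self, resTo_succ _ _ le_rfl, resTo_self]
  | succ m hm ih => rw [resTo_succ _ _ hm, ih, ← resTo_succ]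

/-- The terminal object. -/
def one (n : ℕ) : Psh n where
  obj _ _ := Unit
  res _ _ := id

/-- Binary products. -/
def prod {n : ℕ} (X Y : Psh n) : Psh n where
  obj m h := X.obj m h × Y.obj m h
  res m h := Prod.map (X.res m h) (Y.res m h)

/-- Binary sums. -/
def sum {n : ℕ} (X Y : Psh n) : Psh n where
  obj m h := X.obj m h ⊕ Y.obj m h
  res m h := Sum.map (X.res m h) (Y.res m h)

/-- The set `▷ X` at stage `m`, for `X` given up to stage `m - 1`: a singleton at the first stage,
and the value of `X` at stage `m` at stage `m + 1`. -/
def laterObj : (m : ℕ) → Psh m → Type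
  | 0, _ => Unit
  | m + 1, X => X.obj m (Nat.lt_succ_self m)

def laterRes : (m : ℕ) → (X : Psh (m + 1)) → laterObj (m + 1) X → laterObj m X.pred
  | 0, _ => fun _ => ()
  | m + 1, X => X.res m (Nat.lt_succ_self (m + 1))

/-- The operation `▷ U → U` on codes, at stage `n`. -/
def laterCode {n : ℕ} (X : Psh n) : Psh (n + 1) where
  obj m h := laterObj m (X.restrict (Nat.le_of_lt_succ h))
  res m h := laterRes m (X.restrict (Nat.le_of_lt_succ h))

/-- The later modality `▷`, as an operation on types available now. -/
def later {n : ℕ} (X : Psh n) : Psh n where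
  obj m h := laterObj m (X.restrict (Nat.le_of_lt h))
  res m h := laterRes m (X.restrict (Nat.le_of_lt h))

end Psh

namespace Hom

/-- Restriction of a natural family to earlier stages. -/
def restrict {n k : ℕ} (h : k ≤ n) {X Y : Psh n} (f : Hom X Y) :
    Hom (X.restrict h) (Y.restrict h) where
  app m hm := f.app m (Nat.lt_of_lt_of_le hm h)
  nat m hm := f.nat m (Nat.lt_of_lt_of_le hm h)

protected def id {n : ℕ} (X : Psh n) : Hom X X where
  app _ _ x := x
  nat _ _ _ := rfl

def comp {n : ℕ} {X Y Z : Psh n} (g : Hom Y Z) (f : Hom X Y) : Hom X Z where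
  app m h x := g.app m h (f.app m h x)
  nat m h x := by rw [g.nat, f.nat]

/-- The identity, along an equality of types. -/
def ofEq {n : ℕ} {X Y : Psh n} (h : X = Y) : Hom X Y := h ▸ Hom.id X

def pair {n : ℕ} {X Y Z : Psh n} (f : Hom X Y) (g : Hom X Z) : Hom X (Y.prod Z) where
  app m h x := (f.app m h x, g.app m h x)
  nat m h x := Prod.ext (f.nat m h x) (g.nat m h x)

def fst {n : ℕ} (X Y : Psh n) : Hom (X.prod Y) X where
  app _ _ x := x.1
  nat _ _ _ := rfl

def snd {n : ℕ} (X Y : Psh n) : Hom (X.prod Y) Y where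
  app _ _ x := x.2
  nat _ _ _ := rfl

def inl {n : ℕ} (X Y : Psh n) : Hom X (X.sum Y) where
  app _ _ x := Sum.inl x
  nat _ _ _ := rfl

def inr {n : ℕ} (X Y : Psh n) : Hom Y (X.sum Y) where
  app _ _ x := Sum.inr x
  nat _ _ _ := rfl

/-- Case analysis with parameters in `G`. -/
def copair {n : ℕ} {G X Y Z : Psh n} (f : Hom (G.prod X) Z) (g : Hom (G.prod Y) Z) :
    Hom (G.prod (X.sum Y)) Z where
  app m h
    | (c, Sum.inl x) => f.app m h (c, x)
    | (c, Sum.inr y) => g.app m h (c, y)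
  nat m h
    | (c, Sum.inl x) => f.nat m h (c, x)
    | (c, Sum.inr y) => g.nat m h (c, y)

end Hom

/-- Exponentials: an element of `X → Y` at stage `m` is a natural family of maps
`X j → Y j`, `j ≤ m`. -/
def Psh.arr {n : ℕ} (X Y : Psh n) : Psh n where
  obj _ h := Hom (X.restrict h) (Y.restrict h)
  res m _ f := f.restrict (Nat.le_succ (m + 1))

namespace Hom

def curry {n : ℕ} {G X Y : Psh n} (f : Hom (G.prod X) Y) : Hom G (X.arr Y) where
  app m h g :=
    { app := fun j hj x =>
        f.app j (Nat.lt_of_lt_of_le hj h)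
          (G.resTo (Nat.lt_of_lt_of_le hj h) (Nat.le_of_lt_succ hj) h g, x)
      nat := fun j hj x => by
        refine (f.nat j _ _).trans ?_
        refine congrArg (f.app j _) (Prod.ext ?_ rfl)
        exact G.res_resTo _ _ _ _ }
  nat m h g := by
    apply Hom.ext
    funext j hj x
    refine congrArg (f.app j _) (Prod.ext ?_ rfl)
    exact G.resTo_succ _ (Nat.le_of_lt_succ hj) h g

/-- Evaluation. -/
def eval {n : ℕ} (X Y : Psh n) : Hom ((X.arr Y).prod X) Y where
  app m _ p := p.1.app m (Nat.lt_succ_self m) p.2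
  nat m _ p := p.1.nat m (Nat.lt_succ_self (m + 1)) p.2

/-! ### The later modality and guarded recursion -/

/-- `next : X → ▷ X`. -/
def next {n : ℕ} (X : Psh n) : Hom X X.later where
  app
    | 0, _ => fun _ => ()
    | m + 1, h => X.res m h
  nat
    | 0, _ => fun _ => rfl
    | _ + 1, _ => fun _ => rfl

/-- Action of `▷` on maps. -/
def laterMap {n : ℕ} {X Y : Psh n} (f : Hom X Y) : Hom X.later Y.later where
  app
    | 0, _ => fun _ => ()
    | m + 1, h => f.app m (Nat.lt_of_succ_lt h)
  nat
    | 0, _ => fun _ => rfl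
    | m + 1, h => f.nat m (Nat.lt_of_succ_lt h)

/-- Later application `⊛ : ▷ (X → Y) × ▷ X → ▷ Y`. -/
def laterAp {n : ℕ} (X Y : Psh n) : Hom ((X.arr Y).later.prod X.later) Y.later where
  app
    | 0, _ => fun _ => ()
    | m + 1, h => (eval X Y).app m (Nat.lt_of_succ_lt h)
  nat
    | 0, _ => fun _ => rfl
    | m + 1, h => (eval X Y).nat m (Nat.lt_of_succ_lt h)

end Hom

/-- A `▷`-algebra structure on `X`. -/
abbrev Alg {n : ℕ} (X : Psh n) : Type := Hom X.later X

namespace Alg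

/-- Componentwise algebra structure on a product. -/
def prod {n : ℕ} {X Y : Psh n} (a : Alg X) (b : Alg Y) : Alg (X.prod Y) :=
  Hom.pair (a.comp (Hom.laterMap (Hom.fst X Y))) (b.comp (Hom.laterMap (Hom.snd X Y)))

/-- Pointwise algebra structure on a function type: `f ↦ fun x ↦ b (f ⊛ next x)`. -/
def arr {n : ℕ} (X : Psh n) {Y : Psh n} (b : Alg Y) : Alg (X.arr Y) :=
  Hom.curry (b.comp ((Hom.laterAp X Y).comp
    (Hom.pair (Hom.fst _ _) ((Hom.next X).comp (Hom.snd _ _)))))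

/-- An algebra structure `a` on `X`, available later, gives the algebra structure
`next a ⊛ -` on `▷ X`. -/
def laterCode {n : ℕ} {X : Psh n} (a : Alg X) : Alg X.laterCode where
  app
    | 0, _ => fun _ => ()
    | m + 1, h => a.app m (Nat.lt_of_succ_lt_succ h)
  nat
    | 0, _ => fun _ => rfl
    | m + 1, h => a.nat m (Nat.lt_of_succ_lt_succ h)

end Alg

/-! ### The guarded lifting monad, `L A = A + ▷ (L A)` -/

/-- The set `L A` at stage `m`, for `A` given up to stage `m`. -/
def liftObj : (m : ℕ) → Psh (m + 1) → Type
  | 0, A => A.obj 0 (Nat.lt_succ_self 0) ⊕ Unit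
  | m + 1, A => A.obj (m + 1) (Nat.lt_succ_self (m + 1)) ⊕ liftObj m A.pred

def liftRes : (m : ℕ) → (A : Psh (m + 2)) → liftObj (m + 1) A → liftObj m A.pred
  | 0, A => Sum.map (A.res 0 (Nat.lt_succ_self 1)) (fun _ => ())
  | m + 1, A => Sum.map (A.res (m + 1) (Nat.lt_succ_self (m + 2))) (liftRes m A.pred)

/-- The guarded recursive type `L A`: its value at stage `0` is `A 0 + 1` and at stage `m + 1`
it is `A (m + 1) + (L A) m`. -/
def Psh.lift {n : ℕ} (A : Psh n) : Psh n where
  obj m h := liftObj m (A.restrict h)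
  res m h := liftRes m (A.restrict h)

/-- `η : A → L A`. -/
def Hom.now {n : ℕ} (A : Psh n) : Hom A A.lift where
  app
    | 0, _ => Sum.inl
    | _ + 1, _ => Sum.inl
  nat
    | 0, _ => fun _ => rfl
    | _ + 1, _ => fun _ => rfl

/-- `θ : ▷ (L A) → L A`. -/
def Alg.lift {n : ℕ} (A : Psh n) : Alg A.lift where
  app
    | 0, _ => Sum.inr
    | _ + 1, _ => Sum.inr
  nat
    | 0, _ => fun _ => rfl
    | _ + 1, _ => fun _ => rfl

def extendApp {n : ℕ} {G A B : Psh n} (b : Alg B) (f : Hom (G.prod A) B) :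
    (m : ℕ) → (h : m < n) → G.obj m h → A.lift.obj m h → B.obj m h
  | 0, h, g, Sum.inl a => f.app 0 h (g, a)
  | 0, h, _, Sum.inr u => b.app 0 h u
  | m + 1, h, g, Sum.inl a => f.app (m + 1) h (g, a)
  | m + 1, h, g, Sum.inr t =>
      b.app (m + 1) h (extendApp b f m (Nat.lt_of_succ_lt h) (G.res m h g) t)

theorem extendApp_nat {n : ℕ} {G A B : Psh n} (b : Alg B) (f : Hom (G.prod A) B) :
    ∀ (m : ℕ) (h : m + 1 < n) (g : G.obj (m + 1) h) (x : A.lift.obj (m + 1) h),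
      B.res m h (extendApp b f (m + 1) h g x)
        = extendApp b f m (Nat.lt_of_succ_lt h) (G.res m h g) (A.lift.res m h x)
  | 0, h, g, Sum.inl a => f.nat 0 h (g, a)
  | 0, h, g, Sum.inr t => b.nat 0 h (extendApp b f 0 (Nat.lt_of_succ_lt h) (G.res 0 h g) t)
  | m + 1, h, g, Sum.inl a => f.nat (m + 1) h (g, a)
  | m + 1, h, g, Sum.inr t => by
      refine (b.nat (m + 1) h
        (extendApp b f (m + 1) (Nat.lt_of_succ_lt h) (G.res (m + 1) h g) t)).trans ?_
      refine congrArg (b.app (m + 1) (Nat.lt_of_succ_lt h)) ?_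
      exact extendApp_nat b f m (Nat.lt_of_succ_lt h) (G.res (m + 1) h g) t

/-- The extension of `f : A → B` to the homomorphism of `▷`-algebras `L A → B` with
`η a ↦ f a` and `θ r ↦ θ (next f̂ ⊛ r)`, with parameters in `G`. -/
def Hom.extend {n : ℕ} {G A B : Psh n} (b : Alg B) (f : Hom (G.prod A) B) :
    Hom (G.prod A.lift) B where
  app m h p := extendApp b f m h p.1 p.2
  nat m h p := extendApp_nat b f m h p.1 p.2

/-! ### Types of FPC and their interpretation -/

/-- FPC types with `n` free type variables (de Bruijn indices). -/
inductive Ty : ℕ → Type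
  | var {n : ℕ} (i : Fin n) : Ty n
  | one {n : ℕ} : Ty n
  | sum {n : ℕ} (σ τ : Ty n) : Ty n
  | prod {n : ℕ} (σ τ : Ty n) : Ty n
  | arr {n : ℕ} (σ τ : Ty n) : Ty n
  | mu {n : ℕ} (τ : Ty (n + 1)) : Ty n

namespace Ty

def rename : {k l : ℕ} → (Fin k → Fin l) → Ty k → Ty l
  | _, _, r, var i => var (r i)
  | _, _, _, one => one
  | _, _, r, sum σ τ => sum (rename r σ) (rename r τ)
  | _, _, r, prod σ τ => prod (rename r σ) (rename r τ)
  | _, _, r, arr σ τ => arr (rename r σ) (rename r τ)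
  | _, _, r, mu τ => mu (rename (Fin.cases 0 (fun i => (r i).succ)) τ)

/-- Simultaneous substitution. -/
def subst : {k l : ℕ} → (Fin k → Ty l) → Ty k → Ty l
  | _, _, s, var i => s i
  | _, _, _, one => one
  | _, _, s, sum σ τ => sum (subst s σ) (subst s τ)
  | _, _, s, prod σ τ => prod (subst s σ) (subst s τ)
  | _, _, s, arr σ τ => arr (subst s σ) (subst s τ)
  | _, _, s, mu τ => mu (subst (Fin.cases (var 0) (fun i => rename Fin.succ (s i))) τ)

/-- The unfolding `τ[μα.τ/α]` of `μα.τ`. -/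
def unroll {k : ℕ} (τ : Ty (k + 1)) : Ty k :=
  subst (Fin.cases (mu τ) var) τ

end Ty

/-- The guarded fixed point that interprets `μα.τ`:
`⟦μα.τ⟧ = fix (fun X ρ ↦ ▷ (next ⟦τ⟧ ⊛ (next ρ, X ⊛ next ρ)))`, at every stage. -/
def muDen {k : ℕ} (F : (n : ℕ) → (Fin (k + 1) → Psh n) → Psh n) :
    (n : ℕ) → (Fin k → Psh n) → Psh n
  | 0, _ => Psh.one 0
  | n + 1, ρ => Psh.laterCode
      (F n (Fin.cases (muDen F n (fun i => (ρ i).pred)) (fun i => (ρ i).pred)))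

/-- Interpretation of types, as maps `U ^ k → U` in the topos of trees. -/
def Ty.den : {k : ℕ} → Ty k → (n : ℕ) → (Fin k → Psh n) → Psh n
  | _, .var i => fun _ ρ => ρ i
  | _, .one => fun n _ => (Psh.one n).lift
  | _, .sum σ τ => fun n ρ => ((σ.den n ρ).sum (τ.den n ρ)).lift
  | _, .prod σ τ => fun n ρ => (σ.den n ρ).prod (τ.den n ρ)
  | _, .arr σ τ => fun n ρ => (σ.den n ρ).arr (τ.den n ρ)
  | _, .mu τ => muDen (fun n ρ => τ.den n ρ)

theorem Psh.eq_of_zero (X Y : Psh 0) : X = Y := by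
  cases X; cases Y
  congr
  · funext m h; exact absurd h (Nat.not_lt_zero m)
  · apply Function.hfunext rfl
    rintro m _ ⟨⟩
    apply Function.hfunext rfl
    intro h; exact absurd h (Nat.not_lt_zero _)

/-- The interpretation of types is natural in the stage. -/
theorem Ty.den_pred {k : ℕ} (τ : Ty k) (n : ℕ) (ρ : Fin k → Psh (n + 1)) :
    (τ.den (n + 1) ρ).pred = τ.den n (fun i => (ρ i).pred) := by
  induction τ generalizing n with
  | var i => rfl
  | one => rfl
  | sum σ τ ih₁ ih₂ => simp only [Ty.den, ← ih₁, ← ih₂]; rfl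
  | prod σ τ ih₁ ih₂ => simp only [Ty.den, ← ih₁, ← ih₂]; rfl
  | arr σ τ ih₁ ih₂ => simp only [Ty.den, ← ih₁, ← ih₂]; rfl
  | mu τ ih =>
    cases n with
    | zero => exact Psh.eq_of_zero _ _
    | succ n =>
      have key : ∀ (n : ℕ) (ρ : Fin _ → Psh (n + 1)),
          (muDen (fun n ρ => τ.den n ρ) (n + 1) ρ).pred
            = muDen (fun n ρ => τ.den n ρ) n (fun i => (ρ i).pred) := by
        intro n
        induction n with
        | zero => intro ρ; exact Psh.eq_of_zero _ _
        | succ n ihn =>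
          intro ρ
          have e : (muDen (fun n ρ => τ.den n ρ) (n + 1 + 1) ρ).pred
              = Psh.laterCode (Psh.pred (τ.den (n + 1)
                (Fin.cases (muDen (fun n ρ => τ.den n ρ) (n + 1) (fun i => (ρ i).pred))
                  (fun i => (ρ i).pred)))) := rfl
          rw [e, ih]
          simp only [muDen]
          congr 2
          funext i
          refine Fin.cases ?_ (fun i => ?_) i
          · exact ihn _
          · rfl
      exact key (n + 1) ρ

theorem Ty.den_rename {k l : ℕ} (τ : Ty k) (r : Fin k → Fin l) (n : ℕ) (ρ : Fin l → Psh n) :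
    (τ.rename r).den n ρ = τ.den n (fun i => ρ (r i)) := by
  induction τ generalizing l n with
  | var i => rfl
  | one => rfl
  | sum σ τ ih₁ ih₂ => simp only [Ty.rename, Ty.den, ih₁, ih₂]
  | prod σ τ ih₁ ih₂ => simp only [Ty.rename, Ty.den, ih₁, ih₂]
  | arr σ τ ih₁ ih₂ => simp only [Ty.rename, Ty.den, ih₁, ih₂]
  | mu τ ih =>
    simp only [Ty.rename, Ty.den]
    induction n with
    | zero => rfl
    | succ n ihn =>
      simp only [muDen, ih]
      congr 2
      funext i
      refine Fin.cases ?_ (fun i => ?_) i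
      · have e := ihn (fun i => (ρ i).pred)
        simp only [ih] at e
        exact e
      · rfl

/-- Substitution lemma for types. -/
theorem Ty.den_subst {k l : ℕ} (τ : Ty k) (s : Fin k → Ty l) (n : ℕ) (ρ : Fin l → Psh n) :
    (τ.subst s).den n ρ = τ.den n (fun i => (s i).den n ρ) := by
  induction τ generalizing l n with
  | var i => rfl
  | one => rfl
  | sum σ τ ih₁ ih₂ => simp only [Ty.subst, Ty.den, ih₁, ih₂]
  | prod σ τ ih₁ ih₂ => simp only [Ty.subst, Ty.den, ih₁, ih₂]
  | arr σ τ ih₁ ih₂ => simp only [Ty.subst, Ty.den, ih₁, ih₂]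
  | mu τ ih =>
    simp only [Ty.subst, Ty.den]
    induction n with
    | zero => rfl
    | succ n ihn =>
      simp only [muDen, ih]
      congr 2
      funext i
      refine Fin.cases ?_ (fun i => ?_) i
      · simp only [Fin.cases_zero, Ty.den, ← ih]
        refine (ihn _).trans ?_
        congr 1
        funext i
        exact (Ty.den_pred _ _ _).symm
      · simp only [Fin.cases_succ, Ty.den_rename]
        exact (Ty.den_pred _ _ _).symm

theorem Ty.den_unroll {k : ℕ} (τ : Ty (k + 1)) (n : ℕ) (ρ : Fin k → Psh n) :
    τ.unroll.den n ρ = τ.den n (Fin.cases ((Ty.mu τ).den n ρ) ρ) := by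
  rw [Ty.unroll, Ty.den_subst]
  congr 1
  funext i
  refine Fin.cases ?_ (fun i => ?_) i <;> rfl

/-- `⟦μα.τ⟧` is `⟦τ[μα.τ/α]⟧`, one stage later. -/
theorem Ty.den_mu_succ {k : ℕ} (τ : Ty (k + 1)) (n : ℕ) (ρ : Fin k → Psh (n + 1)) :
    (Ty.mu τ).den (n + 1) ρ = (τ.unroll.den n (fun i => (ρ i).pred)).laterCode := by
  rw [Ty.den_unroll]
  rfl

/-- `⟦μα.τ⟧ = ▷ ⟦τ[μα.τ/α]⟧`. -/
theorem Ty.den_mu {k : ℕ} (τ : Ty (k + 1)) (n : ℕ) (ρ : Fin k → Psh n) :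
    (Ty.mu τ).den n ρ = (τ.unroll.den n ρ).later := by
  cases n with
  | zero => exact Psh.eq_of_zero _ _
  | succ n =>
    rw [Ty.den_mu_succ, ← Ty.den_pred]
    rfl

/-- The algebra structures `θ_τ : ▷ ⟦τ⟧ → ⟦τ⟧` at stage `n + 1`, by induction on `τ`, from those
at stage `n` (which are what is available later).  Types are closed: `k = 0`. -/
def tickStep (n : ℕ)
    (F : {k : ℕ} → (τ : Ty k) → (ρ : Fin k → Psh n) → k = 0 → Alg (τ.den n ρ)) :
    {k : ℕ} → (τ : Ty k) → (ρ : Fin k → Psh (n + 1)) → k = 0 → Alg (τ.den (n + 1) ρ)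
  | _, .var i, _, hk => (Fin.cast hk i).elim0
  | _, .one, _, _ => Alg.lift _
  | _, .sum _ _, _, _ => Alg.lift _
  | _, .prod σ τ, ρ, hk => Alg.prod (tickStep n F σ ρ hk) (tickStep n F τ ρ hk)
  | _, .arr σ τ, ρ, hk => Alg.arr (σ.den (n + 1) ρ) (tickStep n F τ ρ hk)
  | _, .mu τ, ρ, hk =>
      (Ty.den_mu_succ τ n ρ).symm ▸ Alg.laterCode (F τ.unroll (fun i => (ρ i).pred) hk)

/-- `θ`, by guarded recursion and induction on types. -/
def tickRec : (n : ℕ) → {k : ℕ} → (τ : Ty k) → (ρ : Fin k → Psh n) → k = 0 → Alg (τ.den n ρ)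
  | 0, _, _, _, _ => ⟨fun m h => absurd h (Nat.not_lt_zero m),
      fun m h => absurd h (Nat.not_lt_zero (m + 1))⟩
  | n + 1, _, τ, ρ, hk => tickStep n (fun τ ρ hk => tickRec n τ ρ hk) τ ρ hk

/-- Interpretation of closed types, up to stage `n - 1`. -/
def Ty.cden (τ : Ty 0) (n : ℕ) : Psh n := τ.den n (fun i => i.elim0)

/-- `θ_τ : ▷ ⟦τ⟧ → ⟦τ⟧` for closed types. -/
def tick (τ : Ty 0) (n : ℕ) : Alg (τ.cden n) := tickRec n τ _ rfl

/-! ### Terms of FPC -/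

/-- Raw terms, possibly open (de Bruijn indices).  The branches of `case` bind one variable each. -/
inductive Tm : Type
  | unit : Tm
  | var (i : ℕ) : Tm
  | inl (M : Tm) : Tm
  | inr (M : Tm) : Tm
  | case (L M N : Tm) : Tm
  | pair (M N : Tm) : Tm
  | fst (M : Tm) : Tm
  | snd (M : Tm) : Tm
  | lam (τ : Ty 0) (M : Tm) : Tm
  | app (M N : Tm) : Tm
  | fold (M : Tm) : Tm
  | unfold (M : Tm) : Tm

namespace Tm

/-- The action of a renaming under one binder. -/
def up (r : ℕ → ℕ) : ℕ → ℕ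
  | 0 => 0
  | i + 1 => r i + 1

def rename : (ℕ → ℕ) → Tm → Tm
  | _, unit => unit
  | r, var i => var (r i)
  | r, inl M => inl (rename r M)
  | r, inr M => inr (rename r M)
  | r, case L M N => case (rename r L) (rename (up r) M) (rename (up r) N)
  | r, pair M N => pair (rename r M) (rename r N)
  | r, fst M => fst (rename r M)
  | r, snd M => snd (rename r M)
  | r, lam τ M => lam τ (rename (up r) M)
  | r, app M N => app (rename r M) (rename r N)
  | r, fold M => fold (rename r M)
  | r, unfold M => unfold (rename r M)

/-- The action of a substitution under one binder. -/
def ups (s : ℕ → Tm) : ℕ → Tm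
  | 0 => var 0
  | i + 1 => rename Nat.succ (s i)

/-- Capture-avoiding simultaneous substitution. -/
def subst : (ℕ → Tm) → Tm → Tm
  | _, unit => unit
  | s, var i => s i
  | s, inl M => inl (subst s M)
  | s, inr M => inr (subst s M)
  | s, case L M N => case (subst s L) (subst (ups s) M) (subst (ups s) N)
  | s, pair M N => pair (subst s M) (subst s N)
  | s, fst M => fst (subst s M)
  | s, snd M => snd (subst s M)
  | s, lam τ M => lam τ (subst (ups s) M)
  | s, app M N => app (subst s M) (subst s N)
  | s, fold M => fold (subst s M)
  | s, unfold M => unfold (subst s M)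

/-- The substitution that replaces the last variable by `N`. -/
def single (N : Tm) : ℕ → Tm
  | 0 => N
  | i + 1 => var i

/-- `M[N/x]`, for `x` the last variable. -/
def inst (M N : Tm) : Tm := subst (single N) M

end Tm

/-- `Lookup Γ i σ`: the variable `i` has type `σ` in the context `Γ`. -/
inductive Lookup : List (Ty 0) → ℕ → Ty 0 → Type
  | zero {Γ : List (Ty 0)} {σ : Ty 0} : Lookup (σ :: Γ) 0 σ
  | succ {Γ : List (Ty 0)} {i : ℕ} {σ σ' : Ty 0} : Lookup Γ i σ → Lookup (σ' :: Γ) (i + 1) σ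

/-- Typing derivations `Γ ⊢ M : τ`. -/
inductive HasType : List (Ty 0) → Tm → Ty 0 → Type
  | var {Γ : List (Ty 0)} {i : ℕ} {σ : Ty 0} : Lookup Γ i σ → HasType Γ (.var i) σ
  | unit {Γ : List (Ty 0)} : HasType Γ .unit .one
  | lam {Γ : List (Ty 0)} {M : Tm} {σ τ : Ty 0} :
      HasType (σ :: Γ) M τ → HasType Γ (.lam σ M) (.arr σ τ)
  | app {Γ : List (Ty 0)} {M N : Tm} {σ τ : Ty 0} :
      HasType Γ M (.arr σ τ) → HasType Γ N σ → HasType Γ (.app M N) τ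
  | inl {Γ : List (Ty 0)} {M : Tm} {σ τ : Ty 0} :
      HasType Γ M σ → HasType Γ (.inl M) (.sum σ τ)
  | inr {Γ : List (Ty 0)} {M : Tm} {σ τ : Ty 0} :
      HasType Γ M τ → HasType Γ (.inr M) (.sum σ τ)
  | case {Γ : List (Ty 0)} {L M N : Tm} {τ₁ τ₂ σ : Ty 0} :
      HasType Γ L (.sum τ₁ τ₂) → HasType (τ₁ :: Γ) M σ → HasType (τ₂ :: Γ) N σ →
      HasType Γ (.case L M N) σ
  | fst {Γ : List (Ty 0)} {M : Tm} {σ τ : Ty 0} :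
      HasType Γ M (.prod σ τ) → HasType Γ (.fst M) σ
  | snd {Γ : List (Ty 0)} {M : Tm} {σ τ : Ty 0} :
      HasType Γ M (.prod σ τ) → HasType Γ (.snd M) τ
  | pair {Γ : List (Ty 0)} {M N : Tm} {σ τ : Ty 0} :
      HasType Γ M σ → HasType Γ N τ → HasType Γ (.pair M N) (.prod σ τ)
  | unfold {Γ : List (Ty 0)} {M : Tm} {τ : Ty 1} :
      HasType Γ M (.mu τ) → HasType Γ (.unfold M) τ.unroll
  | fold {Γ : List (Ty 0)} {M : Tm} {τ : Ty 1} :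
      HasType Γ M τ.unroll → HasType Γ (.fold M) (.mu τ)

/-! ### Interpretation of terms -/

/-- Interpretation of contexts. -/
def ctxDen : List (Ty 0) → (n : ℕ) → Psh n
  | [], n => Psh.one n
  | σ :: Γ, n => (ctxDen Γ n).prod (σ.cden n)

def Lookup.den {Γ : List (Ty 0)} {i : ℕ} {σ : Ty 0} :
    Lookup Γ i σ → (n : ℕ) → Hom (ctxDen Γ n) (σ.cden n)
  | .zero, _ => Hom.snd _ _
  | .succ l, n => (l.den n).comp (Hom.fst _ _)

/-- Interpretation `⟦Γ ⊢ M : τ⟧ : ⟦Γ⟧ → ⟦τ⟧` of typing derivations; `d.den (n + 1)` is the element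
of the exponential `⟦Γ⟧ → ⟦τ⟧` at stage `n` of the topos of trees. -/
def HasType.den {Γ : List (Ty 0)} {M : Tm} {τ : Ty 0} :
    HasType Γ M τ → (n : ℕ) → Hom (ctxDen Γ n) (τ.cden n)
  | .var l, n => l.den n
  | .unit, n =>
      (Hom.now (Psh.one n)).comp ⟨fun _ _ _ => (), fun _ _ _ => rfl⟩
  | .lam d, n => Hom.curry (d.den n)
  | .app d e, n => (Hom.eval _ _).comp (Hom.pair (d.den n) (e.den n))
  | .inl (σ := σ) (τ := τ) d, n =>
      (Hom.now _).comp ((Hom.inl (σ.cden n) (τ.cden n)).comp (d.den n))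
  | .inr (σ := σ) (τ := τ) d, n =>
      (Hom.now _).comp ((Hom.inr (σ.cden n) (τ.cden n)).comp (d.den n))
  | .case (σ := σ) d e₁ e₂, n =>
      (Hom.extend (tick σ n) (Hom.copair (e₁.den n) (e₂.den n))).comp
        (Hom.pair (Hom.id _) (d.den n))
  | .fst (σ := σ) (τ := τ) d, n => (Hom.fst (σ.cden n) (τ.cden n)).comp (d.den n)
  | .snd (σ := σ) (τ := τ) d, n => (Hom.snd (σ.cden n) (τ.cden n)).comp (d.den n)
  | .pair d e, n => Hom.pair (d.den n) (e.den n)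
  | .unfold (τ := τ) d, n =>
      (tick τ.unroll n).comp ((Hom.ofEq (Ty.den_mu τ n _)).comp (d.den n))
  | .fold (τ := τ) d, n =>
      (Hom.ofEq (Ty.den_mu τ n _).symm).comp ((Hom.next _).comp (d.den n))

/-! ### Operational semantics -/

/-- Small steps `M →ᵏ N`; the last five rules are the closure under evaluation contexts
`E ::= [·] | E M | case E M N | fst E | snd E | unfold E`. -/
inductive Step : Tm → ℕ → Tm → Prop
  | beta (σ : Ty 0) (M N : Tm) : Step (.app (.lam σ M) N) 0 (M.inst N)
  | unfoldFold (M : Tm) : Step (.unfold (.fold M)) 1 M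
  | caseInl (L M N : Tm) : Step (.case (.inl L) M N) 0 (M.inst L)
  | caseInr (L M N : Tm) : Step (.case (.inr L) M N) 0 (N.inst L)
  | fstPair (M N : Tm) : Step (.fst (.pair M N)) 0 M
  | sndPair (M N : Tm) : Step (.snd (.pair M N)) 0 N
  | appCtx {M M' : Tm} {k : ℕ} (N : Tm) : Step M k M' → Step (.app M N) k (.app M' N)
  | caseCtx {L L' : Tm} {k : ℕ} (M N : Tm) :
      Step L k L' → Step (.case L M N) k (.case L' M N)
  | fstCtx {M M' : Tm} {k : ℕ} : Step M k M' → Step (.fst M) k (.fst M')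
  | sndCtx {M M' : Tm} {k : ℕ} : Step M k M' → Step (.snd M) k (.snd M')
  | unfoldCtx {M M' : Tm} {k : ℕ} : Step M k M' → Step (.unfold M) k (.unfold M')

/-- The step-counting reflexive transitive closure `M →ᵏ⁎ N`. -/
inductive Many : Tm → ℕ → Tm → Prop
  | refl (M : Tm) : Many M 0 M
  | head {M M' N : Tm} {k m : ℕ} : Step M k M' → Many M' m N → Many M (k + m) N

/-- The later modality on propositions of the topos of trees (predicates on stages). -/
def laterProp (P : ℕ → Prop) : ℕ → Prop
  | 0 => True
  | n + 1 => P n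

/-- The guarded transitive closure `M ⇒ᵏ N`, a proposition of the topos of trees:
`Guarded k M N n` says that it holds at stage `n`. -/
def Guarded : ℕ → Tm → Tm → ℕ → Prop
  | 0, M, N => fun _ => Many M 0 N
  | k + 1, M, N => fun n =>
      ∃ M' M'' : Tm, Many M 0 M' ∧ Step M' 1 M'' ∧ laterProp (Guarded k M'' N) n

/-! ### Contexts -/

/-- Terms with one hole.  Filling the hole may capture variables.  With named variables, a free
variable of the term in the hole is captured by the innermost enclosing binder of that name,
wherever this binder is; in de Bruijn notation the hole therefore carries the map `r` from the
variables of the term in the hole to the variables in scope at the hole (`r = id` is plain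
textual filling). -/
inductive Cx : Type
  | hole (r : ℕ → ℕ) : Cx
  | lam (σ : Ty 0) (C : Cx) : Cx
  | appL (C : Cx) (N : Tm) : Cx
  | appR (M : Tm) (C : Cx) : Cx
  | inl (C : Cx) : Cx
  | inr (C : Cx) : Cx
  | pairL (C : Cx) (N : Tm) : Cx
  | pairR (M : Tm) (C : Cx) : Cx
  | fst (C : Cx) : Cx
  | snd (C : Cx) : Cx
  | caseS (C : Cx) (M N : Tm) : Cx
  | caseL (L : Tm) (C : Cx) (N : Tm) : Cx
  | caseR (L : Tm) (M : Tm) (C : Cx) : Cx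
  | unfold (C : Cx) : Cx
  | fold (C : Cx) : Cx

/-- `C[P]`. -/
def Cx.fill : Cx → Tm → Tm
  | .hole r, P => P.rename r
  | .lam σ C, P => .lam σ (C.fill P)
  | .appL C N, P => .app (C.fill P) N
  | .appR M C, P => .app M (C.fill P)
  | .inl C, P => .inl (C.fill P)
  | .inr C, P => .inr (C.fill P)
  | .pairL C N, P => .pair (C.fill P) N
  | .pairR M C, P => .pair M (C.fill P)
  | .fst C, P => .fst (C.fill P)
  | .snd C, P => .snd (C.fill P)
  | .caseS C M N, P => .case (C.fill P) M N
  | .caseL L C N, P => .case L (C.fill P) N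
  | .caseR L M C, P => .case L M (C.fill P)
  | .unfold C, P => .unfold (C.fill P)
  | .fold C, P => .fold (C.fill P)

/-- `C` has type `(Γ, τ) → (Δ, σ)`: `Δ ⊢ C[P] : σ` whenever `Γ ⊢ P : τ`. -/
def Cx.HasCxType (C : Cx) (Γ : List (Ty 0)) (τ : Ty 0) (Δ : List (Ty 0)) (σ : Ty 0) : Prop :=
  ∀ P : Tm, Nonempty (HasType Γ P τ) → Nonempty (HasType Δ (C.fill P) σ)

end FPC

/-! The argument passes through the denotation of the whole program. Let `delayedUnit k` be the
element (θ ∘ next)ᵏ(η *) of L1. By soundness (`Step.sound`, `Guarded.sound`), C[M] ⇒ᵏ ⟨⟩ at stage n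
forces the denotation of C[M] to agree with `delayedUnit k` there. By compositionality
(`Cx.den_congr`), C[N] has the same denotation. By adequacy (`Guarded.adequacy`), a closed term of
type 1 with this denotation satisfies ⇒ᵏ ⟨⟩ at that stage.

Soundness rests on two facts: β-steps preserve denotations by the substitution lemma, and each
evaluation frame acts as a homomorphism of ▷-algebras in its evaluation position, so the θ ∘ next
produced by an unfold-fold step moves outwards through it.

Adequacy uses a logical relation `Rel` between semantic elements and terms. It is defined by guarded
recursion on the stage and by induction on types that stops at μ, whose clause speaks of the
unrolled type one stage later. The relation is stable under restriction (`Rel.next`), under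
→⁰-expansion (`Rel.expand`) and under θ (`Rel.tick`); the fundamental lemma `HasType.rel` follows.
At type 1, being related to `delayedUnit k` is exactly ⇒ᵏ ⟨⟩.

Terms need not have unique types or derivations, since `inl` and `inr` do not record the other
summand, and denotations belong to derivations. Hence the lemmas produce a derivation together with
an equation for its denotation. For the same reason the derivations of C[M] and C[N] are both
obtained from one of C[P], where P is a term that can be typed at the hole only as intended
(`exists_pins`). -/

namespace FPC

/-! ### Substitution in raw terms -/

namespace Tm

/-- Extension of a substitution by a term for the last variable. -/
def cons (N : Tm) (s : ℕ → Tm) : ℕ → Tm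
  | 0 => N
  | i + 1 => s i

theorem ups_var : ups var = var := by
  funext i; cases i <;> rfl

theorem subst_var (M : Tm) : subst var M = M := by
  induction M <;> simp_all [subst, ups_var]

theorem up_comp (r r' : ℕ → ℕ) : up r' ∘ up r = up (r' ∘ r) := by
  funext i; cases i <;> rfl

theorem rename_rename (M : Tm) (r r' : ℕ → ℕ) :
    rename r' (rename r M) = rename (r' ∘ r) M := by
  induction M generalizing r r' <;> simp_all [rename, up_comp]

theorem ups_comp_up (r : ℕ → ℕ) (s : ℕ → Tm) : ups s ∘ up r = ups (s ∘ r) := by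
  funext i; cases i <;> rfl

theorem subst_rename (M : Tm) (r : ℕ → ℕ) (s : ℕ → Tm) :
    subst s (rename r M) = subst (s ∘ r) M := by
  induction M generalizing r s <;> simp_all [rename, subst, ups_comp_up]

theorem rename_up_comp_ups (r : ℕ → ℕ) (s : ℕ → Tm) :
    rename (up r) ∘ ups s = ups (rename r ∘ s) := by
  funext i
  cases i with
  | zero => rfl
  | succ i => simp only [Function.comp_apply, ups, rename_rename]; rfl

theorem rename_subst (M : Tm) (r : ℕ → ℕ) (s : ℕ → Tm) :
    rename r (subst s M) = subst (rename r ∘ s) M := by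
  induction M generalizing r s <;> simp_all [rename, subst, rename_up_comp_ups]

theorem subst_ups_comp_ups (s t : ℕ → Tm) : subst (ups t) ∘ ups s = ups (subst t ∘ s) := by
  funext i
  cases i with
  | zero => rfl
  | succ i => simp only [Function.comp_apply, ups, rename_subst, subst_rename]; rfl

theorem subst_subst (M : Tm) (s t : ℕ → Tm) : subst t (subst s M) = subst (subst t ∘ s) M := by
  induction M generalizing s t <;> simp_all [subst, subst_ups_comp_ups]

/-- This is the form in which β- and case-reducts arise in the fundamental lemma: contracting a
redex extends the environment by one term. -/
theorem inst_subst_ups (M N : Tm) (s : ℕ → Tm) :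
    inst (subst (ups s) M) N = subst (cons N s) M := by
  rw [inst, subst_subst]
  congr 1
  funext i
  cases i with
  | zero => rfl
  | succ i =>
    simp only [Function.comp_apply, ups, subst_rename, cons]
    exact subst_var _

end Tm

/-! ### Algebra structures of closed types -/

/-- Induction on closed types that does not look under `μ`. -/
theorem Ty.closed_induction {P : Ty 0 → Prop} (one : P .one)
    (sum : ∀ σ τ, P σ → P τ → P (.sum σ τ)) (prod : ∀ σ τ, P σ → P τ → P (.prod σ τ))
    (arr : ∀ σ τ, P σ → P τ → P (.arr σ τ)) (mu : ∀ τ, P (.mu τ)) (τ : Ty 0) : P τ := by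
  -- Induction on the indexed family needs a variable index. Under `k = 0` the variable case is
  -- void, and only the `μ` case enters a larger index.
  have key : ∀ {k : ℕ} (τ : Ty k) (h : k = 0), P (h ▸ τ) := by
    intro k τ
    induction τ with
    | var i => intro h; subst h; exact i.elim0
    | one => intro h; subst h; exact one
    | sum σ τ ih₁ ih₂ => intro h; subst h; exact sum _ _ (ih₁ rfl) (ih₂ rfl)
    | prod σ τ ih₁ ih₂ => intro h; subst h; exact prod _ _ (ih₁ rfl) (ih₂ rfl)
    | arr σ τ ih₁ ih₂ => intro h; subst h; exact arr _ _ (ih₁ rfl) (ih₂ rfl)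
    | mu τ _ => intro h; subst h; exact mu _
  exact key τ rfl

/-- There are no stages below height 0. This settles the base case of every guarded recursion on
maps. -/
theorem Hom.heq_of_zero {X Y X' Y' : Psh 0} (f : Hom X Y) (g : Hom X' Y') : HEq f g := by
  obtain rfl := Psh.eq_of_zero X X'
  obtain rfl := Psh.eq_of_zero Y Y'
  apply heq_of_eq
  ext m h
  exact absurd h (Nat.not_lt_zero m)

theorem Hom.ofEq_trans {n : ℕ} {X Y Z : Psh n} (e : X = Y) (e' : Y = Z) :
    (Hom.ofEq e').comp (Hom.ofEq e) = Hom.ofEq (e.trans e') := by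
  subst e; subst e'; rfl

/-- Restriction of an algebra structure by one stage. -/
def Alg.pred {n : ℕ} {X : Psh (n + 1)} (a : Alg X) : Alg X.pred := Hom.restrict (Nat.le_succ n) a

theorem Alg.pred_lift {n : ℕ} (A : Psh (n + 1)) :
    (Alg.lift A).pred = Alg.lift A.pred := by
  ext m h x
  cases m <;> rfl

theorem Alg.pred_prod {n : ℕ} {X Y : Psh (n + 1)} (a : Alg X) (b : Alg Y) :
    (Alg.prod a b).pred = Alg.prod a.pred b.pred := by
  ext m h x
  cases m <;> rfl

theorem Psh.restrict_resTo {n : ℕ} (X : Psh (n + 1)) {j m : ℕ} (hj : j < n) (hjm : j ≤ m)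
    (h : m < n) (x : X.pred.obj m h) :
    X.pred.resTo hj hjm h x = X.resTo (Nat.lt_succ_of_lt hj) hjm (Nat.lt_succ_of_lt h) x := by
  induction m, hjm using Nat.le_induction with
  | base => exact (resTo_self _ _ _).trans (resTo_self X _ x).symm
  | succ m hm ih =>
    exact (resTo_succ _ _ hm _ _).trans ((ih _ _).trans (resTo_succ _ _ hm _ _).symm)

theorem Alg.pred_arr {n : ℕ} (X : Psh (n + 1)) {Y : Psh (n + 1)} (b : Alg Y) :
    (Alg.arr X b).pred = Alg.arr X.pred b.pred := by
  ext m h x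
  apply Hom.ext
  funext j hj y
  have e := Psh.restrict_resTo (Psh.later (Psh.arr X Y)) (Nat.lt_of_lt_of_le hj h)
    (Nat.le_of_lt_succ hj) h x
  refine congrArg (b.app j _) ?_
  cases j with
  | zero => rfl
  | succ j => exact congrArg (fun f : Hom _ _ => f.app j (Nat.lt_succ_self j)
      (X.res j (Nat.lt_of_lt_of_le hj (Nat.le_succ_of_le h)) y)) e.symm

theorem Alg.pred_laterCode {n : ℕ} {X : Psh (n + 1)} (a : Alg X) :
    (Alg.laterCode a).pred = Alg.laterCode a.pred := by
  ext m h x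
  cases m <;> rfl

/-- Naturality of θ in the height. The equality is heterogeneous because `Ty.den_pred` holds only
propositionally; the auxiliary facts are congruences for it. Structural cases follow by induction on
the type, while `μ` uses induction on `n`, its θ being that of the unrolling at one height less. -/
theorem tickRec_pred (n : ℕ) : ∀ {k : ℕ} (τ : Ty k) (ρ : Fin k → Psh (n + 1)) (hk : k = 0),
    HEq (tickRec (n + 1) τ ρ hk).pred (tickRec n τ (fun i => (ρ i).pred) hk) := by
  have hlift : ∀ {n : ℕ} {A B : Psh n}, A = B → HEq (Alg.lift A) (Alg.lift B) := by
    rintro n A _ rfl; rfl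
  have hprod : ∀ {n : ℕ} {X X' Y Y' : Psh n} {a : Alg X} {a' : Alg X'} {b : Alg Y} {b' : Alg Y'},
      X = X' → Y = Y' → HEq a a' → HEq b b' → HEq (Alg.prod a b) (Alg.prod a' b') := by
    rintro n X _ Y _ a _ b _ rfl rfl ⟨⟩ ⟨⟩; rfl
  have harr : ∀ {n : ℕ} {X X' Y Y' : Psh n} {b : Alg Y} {b' : Alg Y'},
      X = X' → Y = Y' → HEq b b' → HEq (Alg.arr X b) (Alg.arr X' b') := by
    rintro n X _ Y _ b _ rfl rfl ⟨⟩; rfl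
  have hlater : ∀ {n : ℕ} {X X' : Psh n} {a : Alg X} {a' : Alg X'},
      X = X' → HEq a a' → HEq (Alg.laterCode a) (Alg.laterCode a') := by
    rintro n X _ a _ rfl ⟨⟩; rfl
  have hcast : ∀ {n : ℕ} {X Y : Psh n} (e : X = Y) (a : Alg X), HEq (e ▸ a : Alg Y) a := by
    rintro n X _ rfl a; rfl
  have hpred : ∀ {n : ℕ} {X Y : Psh (n + 1)} {a : Alg X} {b : Alg Y}, X = Y → HEq a b →
      HEq a.pred b.pred := by
    rintro n X _ a _ rfl ⟨⟩; rfl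
  induction n with
  | zero => intros; exact Hom.heq_of_zero _ _
  | succ n ih =>
    intro k τ
    induction τ with
    | var i => intro ρ hk; subst hk; exact i.elim0
    | one => intro ρ hk; exact heq_of_eq (Alg.pred_lift _)
    | sum σ τ ih₁ ih₂ =>
      intro ρ hk
      refine (heq_of_eq (Alg.pred_lift _)).trans ?_
      exact hlift (congrArg₂ Psh.sum (Ty.den_pred σ _ _) (Ty.den_pred τ _ _))
    | prod σ τ ih₁ ih₂ =>
      intro ρ hk
      exact (heq_of_eq (Alg.pred_prod _ _)).trans
        (hprod (Ty.den_pred _ _ _) (Ty.den_pred _ _ _) (ih₁ ρ hk) (ih₂ ρ hk))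
    | arr σ τ ih₁ ih₂ =>
      intro ρ hk
      exact (heq_of_eq (Alg.pred_arr _ _)).trans
        (harr (Ty.den_pred _ _ _) (Ty.den_pred _ _ _) (ih₂ ρ hk))
    | mu τ _ =>
      intro ρ hk
      refine (hpred (Ty.den_mu_succ τ _ ρ) (hcast _ _)).trans ?_
      refine (heq_of_eq (Alg.pred_laterCode _)).trans ?_
      exact (hlater (Ty.den_pred _ _ _) (ih _ _ hk)).trans (hcast _ _).symm

theorem tick_one (n : ℕ) : tick .one n = Alg.lift (Psh.one n) := by
  cases n with
  | zero => exact eq_of_heq (Hom.heq_of_zero _ _)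
  | succ n => rfl

theorem tick_sum (σ τ : Ty 0) (n : ℕ) :
    tick (.sum σ τ) n = Alg.lift ((σ.cden n).sum (τ.cden n)) := by
  cases n with
  | zero => exact eq_of_heq (Hom.heq_of_zero _ _)
  | succ n => rfl

theorem tick_prod (σ τ : Ty 0) (n : ℕ) :
    tick (.prod σ τ) n = Alg.prod (tick σ n) (tick τ n) := by
  cases n with
  | zero => exact eq_of_heq (Hom.heq_of_zero _ _)
  | succ n => rfl

theorem tick_arr (σ τ : Ty 0) (n : ℕ) :
    tick (.arr σ τ) n = Alg.arr (σ.cden n) (tick τ n) := by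
  cases n with
  | zero => exact eq_of_heq (Hom.heq_of_zero _ _)
  | succ n => rfl

/-- The isomorphism `⟦μα.τ⟧ → ▷ ⟦τ[μα.τ/α]⟧`. -/
def muOut (τ : Ty 1) (n : ℕ) : Hom ((Ty.mu τ).cden n) (τ.unroll.cden n).later :=
  Hom.ofEq (Ty.den_mu τ n _)

/-- The isomorphism `▷ ⟦τ[μα.τ/α]⟧ → ⟦μα.τ⟧`. -/
def muIn (τ : Ty 1) (n : ℕ) : Hom (τ.unroll.cden n).later ((Ty.mu τ).cden n) :=
  Hom.ofEq (Ty.den_mu τ n _).symm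

theorem muOut_muIn (τ : Ty 1) (n : ℕ) : (muOut τ n).comp (muIn τ n) = Hom.id _ :=
  Hom.ofEq_trans _ _

/-- By definition θ at `μ` is built from θ of the unrolling at the previous height, whereas
`laterMap` uses θ at the current height; `tickRec_pred` identifies the two. -/
theorem muOut_tick (τ : Ty 1) (n : ℕ) :
    (muOut τ n).comp (tick (.mu τ) n)
      = (Hom.laterMap (tick τ.unroll n)).comp (Hom.laterMap (muOut τ n)) := by
  have key : ∀ {n : ℕ} {X : Psh (n + 1)} {Y : Psh n} {Z : Psh (n + 1)} {a : Alg X} {b : Alg Y}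
      (e₁ : Y.laterCode = Z) (e₂ : Z = X.later), X.pred = Y → HEq a.pred b →
      (Hom.ofEq e₂).comp (e₁ ▸ Alg.laterCode b : Alg Z)
        = (Hom.laterMap a).comp (Hom.laterMap (Hom.ofEq e₂)) := by
    rintro n X _ _ a _ rfl e₂ rfl ⟨⟩
    ext m h x
    cases m <;> rfl
  cases n with
  | zero => exact eq_of_heq (Hom.heq_of_zero _ _)
  | succ n => exact key _ _ (Ty.den_pred _ _ _) (tickRec_pred n _ _ rfl)

/-! ### Renaming and substitution in typing derivations -/

theorem Hom.nat_resTo {n : ℕ} {X Y : Psh n} (f : Hom X Y) {j m : ℕ} (hj : j < n) (hjm : j ≤ m)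
    (h : m < n) (x : X.obj m h) :
    Y.resTo hj hjm h (f.app m h x) = f.app j hj (X.resTo hj hjm h x) := by
  induction m, hjm using Nat.le_induction with
  | base => rw [Psh.resTo_self, Psh.resTo_self]
  | succ m hm ih => rw [Psh.resTo_succ _ _ hm, Psh.resTo_succ _ _ hm, f.nat, ih]

/-- The map `f × X`. -/
def Hom.lift {n : ℕ} {G G' : Psh n} (f : Hom G G') (X : Psh n) : Hom (G.prod X) (G'.prod X) :=
  Hom.pair (f.comp (Hom.fst G X)) (Hom.snd G X)

theorem Hom.curry_comp {n : ℕ} {G G' X Y : Psh n} (f : Hom G G') (g : Hom (G'.prod X) Y) :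
    Hom.curry (g.comp (f.lift X)) = (Hom.curry g).comp f := by
  ext m h x
  apply Hom.ext
  funext j hj y
  exact congrArg (fun z => g.app j _ (z, y)) (f.nat_resTo _ _ _ _).symm

theorem extendApp_comp {n : ℕ} {G G' A B : Psh n} (b : Alg B) (f : Hom G G')
    (g : Hom (G'.prod A) B) : ∀ (m : ℕ) (h : m < n) (x : G.obj m h) (y : A.lift.obj m h),
    extendApp b (g.comp (f.lift A)) m h x y = extendApp b g m h (f.app m h x) y
  | 0, _, _, Sum.inl _ => rfl
  | 0, _, _, Sum.inr _ => rfl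
  | _ + 1, _, _, Sum.inl _ => rfl
  | m + 1, h, x, Sum.inr t =>
    congrArg (b.app (m + 1) h) ((extendApp_comp b f g m (Nat.lt_of_succ_lt h) (G.res m h x) t).trans
      (congrArg (fun z => extendApp b g m (Nat.lt_of_succ_lt h) z t) (f.nat m h x).symm))

theorem Hom.extend_comp {n : ℕ} {G G' A B C : Psh n} (b : Alg C) (f : Hom G G')
    (g₁ : Hom (G'.prod A) C) (g₂ : Hom (G'.prod B) C) :
    Hom.extend b (Hom.copair (g₁.comp (f.lift A)) (g₂.comp (f.lift B)))
      = (Hom.extend b (Hom.copair g₁ g₂)).comp (f.lift _) := by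
  have e : Hom.copair (g₁.comp (f.lift A)) (g₂.comp (f.lift B))
      = (Hom.copair g₁ g₂).comp (f.lift _) := by
    ext m h x
    obtain ⟨x, y | y⟩ := x <;> rfl
  rw [e]
  ext m h x
  exact extendApp_comp b f _ m h x.1 x.2

/-- `r` maps the variables of `Γ` to variables of `Δ` of the same type, and `f` interprets it. -/
def RenamesTo (n : ℕ) (Γ Δ : List (Ty 0)) (r : ℕ → ℕ) (f : Hom (ctxDen Δ n) (ctxDen Γ n)) : Prop :=
  ∀ (i : ℕ) (σ : Ty 0) (l : Lookup Γ i σ), ∃ l' : Lookup Δ (r i) σ, l'.den n = (l.den n).comp f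

theorem RenamesTo.up {n : ℕ} {Γ Δ : List (Ty 0)} {r : ℕ → ℕ} {f : Hom (ctxDen Δ n) (ctxDen Γ n)}
    (h : RenamesTo n Γ Δ r f) (σ : Ty 0) :
    RenamesTo n (σ :: Γ) (σ :: Δ) (Tm.up r) (f.lift (σ.cden n)) := by
  intro i τ l
  cases l with
  | zero => exact ⟨.zero, rfl⟩
  | succ l =>
    obtain ⟨l', e⟩ := h _ _ l
    exact ⟨.succ l', congrArg (fun g => Hom.comp g (Hom.fst _ _)) e⟩

/-- The new derivation copies the shape of `d`, so the semantic equation follows constructor by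
constructor. It could not be asserted of an arbitrary derivation of the renamed term. -/
theorem HasType.rename_den {n : ℕ} {Γ : List (Ty 0)} {M : Tm} {τ : Ty 0} (d : HasType Γ M τ)
    {Δ : List (Ty 0)} {r : ℕ → ℕ} {f : Hom (ctxDen Δ n) (ctxDen Γ n)} (hr : RenamesTo n Γ Δ r f) :
    ∃ d' : HasType Δ (M.rename r) τ, d'.den n = (d.den n).comp f := by
  induction d generalizing Δ r with
  | var l => obtain ⟨l', e⟩ := hr _ _ l; exact ⟨.var l', e⟩
  | unit => exact ⟨.unit, rfl⟩
  | lam d ih =>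
    obtain ⟨d', e⟩ := ih (hr.up _)
    exact ⟨.lam d', (congrArg Hom.curry e).trans (Hom.curry_comp f _)⟩
  | app d₁ d₂ ih₁ ih₂ =>
    obtain ⟨d₁', e₁⟩ := ih₁ hr
    obtain ⟨d₂', e₂⟩ := ih₂ hr
    exact ⟨.app d₁' d₂', congrArg₂ (fun g g' => (Hom.eval _ _).comp (Hom.pair g g')) e₁ e₂⟩
  | @inl _ _ σ τ d ih =>
    obtain ⟨d', e⟩ := ih hr
    exact ⟨.inl d', congrArg (fun g => (Hom.now _).comp ((Hom.inl (σ.cden n) (τ.cden n)).comp g)) e⟩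
  | @inr _ _ σ τ d ih =>
    obtain ⟨d', e⟩ := ih hr
    exact ⟨.inr d', congrArg (fun g => (Hom.now _).comp ((Hom.inr (σ.cden n) (τ.cden n)).comp g)) e⟩
  | @case _ _ _ _ _ _ σ d d₁ d₂ ih ih₁ ih₂ =>
    obtain ⟨d', e⟩ := ih hr
    obtain ⟨d₁', e₁⟩ := ih₁ (hr.up _)
    obtain ⟨d₂', e₂⟩ := ih₂ (hr.up _)
    refine ⟨.case d' d₁' d₂', ?_⟩
    refine (congrArg₂ (fun g g' => (Hom.extend (tick σ n) g).comp (Hom.pair (Hom.id _) g'))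
      (congrArg₂ Hom.copair e₁ e₂) e).trans ?_
    exact congrArg (fun g => Hom.comp g (Hom.pair (Hom.id _) ((d.den n).comp f)))
      (Hom.extend_comp (tick σ n) f _ _)
  | @fst _ _ σ τ d ih =>
    obtain ⟨d', e⟩ := ih hr
    exact ⟨.fst d', congrArg (Hom.comp (Hom.fst (σ.cden n) (τ.cden n))) e⟩
  | @snd _ _ σ τ d ih =>
    obtain ⟨d', e⟩ := ih hr
    exact ⟨.snd d', congrArg (Hom.comp (Hom.snd (σ.cden n) (τ.cden n))) e⟩
  | pair d₁ d₂ ih₁ ih₂ =>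
    obtain ⟨d₁', e₁⟩ := ih₁ hr
    obtain ⟨d₂', e₂⟩ := ih₂ hr
    exact ⟨.pair d₁' d₂', congrArg₂ Hom.pair e₁ e₂⟩
  | @unfold _ _ τ d ih =>
    obtain ⟨d', e⟩ := ih hr
    exact ⟨.unfold d', congrArg (fun g => (tick τ.unroll n).comp ((muOut τ n).comp g)) e⟩
  | @fold _ _ τ d ih =>
    obtain ⟨d', e⟩ := ih hr
    exact ⟨.fold d', congrArg (fun g => (muIn τ n).comp ((Hom.next _).comp g)) e⟩

/-- `s` maps the variables of `Γ` to terms in `Δ` of the same type, and `f` interprets it. -/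
def SubstsTo (n : ℕ) (Γ Δ : List (Ty 0)) (s : ℕ → Tm) (f : Hom (ctxDen Δ n) (ctxDen Γ n)) : Prop :=
  ∀ (i : ℕ) (σ : Ty 0) (l : Lookup Γ i σ), ∃ d : HasType Δ (s i) σ, d.den n = (l.den n).comp f

theorem SubstsTo.ups {n : ℕ} {Γ Δ : List (Ty 0)} {s : ℕ → Tm} {f : Hom (ctxDen Δ n) (ctxDen Γ n)}
    (h : SubstsTo n Γ Δ s f) (σ : Ty 0) :
    SubstsTo n (σ :: Γ) (σ :: Δ) (Tm.ups s) (f.lift (σ.cden n)) := by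
  intro i τ l
  cases l with
  | zero => exact ⟨.var .zero, rfl⟩
  | succ l =>
    obtain ⟨d, e⟩ := h _ _ l
    obtain ⟨d', e'⟩ := d.rename_den (n := n) (Δ := σ :: Δ) (r := Nat.succ) (f := Hom.fst _ _)
      (fun _ _ l => ⟨.succ l, rfl⟩)
    exact ⟨d', e'.trans (congrArg (fun g => Hom.comp g (Hom.fst _ _)) e)⟩

theorem HasType.subst_den {n : ℕ} {Γ : List (Ty 0)} {M : Tm} {τ : Ty 0} (d : HasType Γ M τ)
    {Δ : List (Ty 0)} {s : ℕ → Tm} {f : Hom (ctxDen Δ n) (ctxDen Γ n)} (hr : SubstsTo n Γ Δ s f) :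
    ∃ d' : HasType Δ (M.subst s) τ, d'.den n = (d.den n).comp f := by
  induction d generalizing Δ s with
  | var l => exact hr _ _ l
  | unit => exact ⟨.unit, rfl⟩
  | lam d ih =>
    obtain ⟨d', e⟩ := ih (hr.ups _)
    exact ⟨.lam d', (congrArg Hom.curry e).trans (Hom.curry_comp f _)⟩
  | app d₁ d₂ ih₁ ih₂ =>
    obtain ⟨d₁', e₁⟩ := ih₁ hr
    obtain ⟨d₂', e₂⟩ := ih₂ hr
    exact ⟨.app d₁' d₂', congrArg₂ (fun g g' => (Hom.eval _ _).comp (Hom.pair g g')) e₁ e₂⟩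
  | @inl _ _ σ τ d ih =>
    obtain ⟨d', e⟩ := ih hr
    exact ⟨.inl d', congrArg (fun g => (Hom.now _).comp ((Hom.inl (σ.cden n) (τ.cden n)).comp g)) e⟩
  | @inr _ _ σ τ d ih =>
    obtain ⟨d', e⟩ := ih hr
    exact ⟨.inr d', congrArg (fun g => (Hom.now _).comp ((Hom.inr (σ.cden n) (τ.cden n)).comp g)) e⟩
  | @case _ _ _ _ _ _ σ d d₁ d₂ ih ih₁ ih₂ =>
    obtain ⟨d', e⟩ := ih hr
    obtain ⟨d₁', e₁⟩ := ih₁ (hr.ups _)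
    obtain ⟨d₂', e₂⟩ := ih₂ (hr.ups _)
    refine ⟨.case d' d₁' d₂', ?_⟩
    refine (congrArg₂ (fun g g' => (Hom.extend (tick σ n) g).comp (Hom.pair (Hom.id _) g'))
      (congrArg₂ Hom.copair e₁ e₂) e).trans ?_
    exact congrArg (fun g => Hom.comp g (Hom.pair (Hom.id _) ((d.den n).comp f)))
      (Hom.extend_comp (tick σ n) f _ _)
  | @fst _ _ σ τ d ih =>
    obtain ⟨d', e⟩ := ih hr
    exact ⟨.fst d', congrArg (Hom.comp (Hom.fst (σ.cden n) (τ.cden n))) e⟩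
  | @snd _ _ σ τ d ih =>
    obtain ⟨d', e⟩ := ih hr
    exact ⟨.snd d', congrArg (Hom.comp (Hom.snd (σ.cden n) (τ.cden n))) e⟩
  | pair d₁ d₂ ih₁ ih₂ =>
    obtain ⟨d₁', e₁⟩ := ih₁ hr
    obtain ⟨d₂', e₂⟩ := ih₂ hr
    exact ⟨.pair d₁' d₂', congrArg₂ Hom.pair e₁ e₂⟩
  | @unfold _ _ τ d ih =>
    obtain ⟨d', e⟩ := ih hr
    exact ⟨.unfold d', congrArg (fun g => (tick τ.unroll n).comp ((muOut τ n).comp g)) e⟩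
  | @fold _ _ τ d ih =>
    obtain ⟨d', e⟩ := ih hr
    exact ⟨.fold d', congrArg (fun g => (muIn τ n).comp ((Hom.next _).comp g)) e⟩

theorem HasType.inst_den {n : ℕ} {Γ : List (Ty 0)} {M N : Tm} {σ τ : Ty 0}
    (d : HasType (σ :: Γ) M τ) (e : HasType Γ N σ) :
    ∃ d' : HasType Γ (M.inst N) τ, d'.den n = (d.den n).comp (Hom.pair (Hom.id _) (e.den n)) := by
  refine d.subst_den fun i ρ l => ?_
  cases l with
  | zero => exact ⟨e, rfl⟩
  | succ l => exact ⟨.var l, rfl⟩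

/-! ### Soundness -/

/-- `k` applications of `θ ∘ next`. -/
def delay {n : ℕ} {G X : Psh n} (a : Alg X) : ℕ → Hom G X → Hom G X
  | 0, f => f
  | k + 1, f => a.comp ((Hom.next X).comp (delay a k f))

theorem Hom.laterMap_next {n : ℕ} {X Y : Psh n} (f : Hom X Y) :
    (Hom.laterMap f).comp (Hom.next X) = (Hom.next Y).comp f := by
  ext m h x
  cases m with
  | zero => rfl
  | succ m => exact (f.nat m h x).symm

theorem comp_curry_eval {n : ℕ} {G X Y : Psh n} (f : Hom (G.prod X) Y) (g : Hom G X) :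
    (Hom.eval X Y).comp (Hom.pair (Hom.curry f) g) = f.comp (Hom.pair (Hom.id G) g) := by
  ext m h x
  exact congrArg (fun z => f.app m h (z, _)) (Psh.resTo_self _ _ _)

theorem extend_now {n : ℕ} {G A C : Psh n} (b : Alg C)
    (g : Hom (G.prod A) C) (f : Hom G A) :
    (Hom.extend b g).comp (Hom.pair (Hom.id G) ((Hom.now _).comp f))
      = g.comp (Hom.pair (Hom.id G) f) := by
  ext m h x
  cases m <;> rfl

/-- A delay of the scrutinee becomes a delay of the whole `case`, because the extension is an
algebra homomorphism. The next four lemmas do the same for application, the projections and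
`unfold`. -/
theorem extend_delay {n : ℕ} {G A B : Psh n} (b : Alg B) (g : Hom (G.prod A) B)
    (f : Hom G A.lift) :
    (Hom.extend b g).comp (Hom.pair (Hom.id G) ((Alg.lift A).comp ((Hom.next _).comp f)))
      = b.comp ((Hom.next _).comp ((Hom.extend b g).comp (Hom.pair (Hom.id G) f))) := by
  ext m h x
  cases m with
  | zero => rfl
  | succ m => exact congrArg (b.app (m + 1) h) (extendApp_nat b g m h x (f.app (m + 1) h x)).symm

theorem eval_arr_delay {n : ℕ} {G X Y : Psh n} (b : Alg Y) (f : Hom G (X.arr Y)) (g : Hom G X) :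
    (Hom.eval X Y).comp (Hom.pair ((Alg.arr X b).comp ((Hom.next _).comp f)) g)
      = b.comp ((Hom.next _).comp ((Hom.eval X Y).comp (Hom.pair f g))) := by
  ext m h x
  have e := Psh.resTo_self (X.arr Y).later h ((Hom.next _).app m h (f.app m h x))
  refine congrArg (b.app m h) ?_
  refine (congrArg (fun z => (Hom.laterAp X Y).app m h
    (z, (Hom.next X).app m h (g.app m h x))) e).trans ?_
  cases m with
  | zero => rfl
  | succ m => exact ((Hom.eval X Y).nat m h (f.app (m + 1) h x, g.app (m + 1) h x)).symm

theorem prod_delay_fst {n : ℕ} {G X Y : Psh n} (a : Alg X) (b : Alg Y) (f : Hom G (X.prod Y)) :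
    (Hom.fst X Y).comp ((Alg.prod a b).comp ((Hom.next _).comp f))
      = a.comp ((Hom.next _).comp ((Hom.fst X Y).comp f)) := by
  ext m h x
  cases m <;> rfl

theorem prod_delay_snd {n : ℕ} {G X Y : Psh n} (a : Alg X) (b : Alg Y) (f : Hom G (X.prod Y)) :
    (Hom.snd X Y).comp ((Alg.prod a b).comp ((Hom.next _).comp f))
      = b.comp ((Hom.next _).comp ((Hom.snd X Y).comp f)) := by
  ext m h x
  cases m <;> rfl

theorem unfold_delay {n : ℕ} {G : Psh n} (τ : Ty 1) (f : Hom G ((Ty.mu τ).cden n)) :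
    (tick τ.unroll n).comp ((muOut τ n).comp ((tick (.mu τ) n).comp ((Hom.next _).comp f)))
      = (tick τ.unroll n).comp ((Hom.next _).comp
          ((tick τ.unroll n).comp ((muOut τ n).comp f))) := by
  have e₁ := congrArg (fun g => g.comp ((Hom.next _).comp f)) (muOut_tick τ n)
  have e₂ := congrArg (fun g => (Hom.laterMap (tick τ.unroll n)).comp (g.comp f))
    (Hom.laterMap_next (muOut τ n))
  have e₃ := congrArg (fun g => g.comp ((muOut τ n).comp f)) (Hom.laterMap_next (tick τ.unroll n))
  exact congrArg (Hom.comp (tick τ.unroll n)) (e₁.trans (e₂.trans e₃))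

/-- Reductions preserve types, and each `unfold`-`fold` step is interpreted by `θ ∘ next`. -/
theorem Step.sound {M M' : Tm} {k : ℕ} (h : Step M k M') (n : ℕ) {Γ : List (Ty 0)} {τ : Ty 0}
    (d : HasType Γ M τ) :
    k ≤ 1 ∧ ∃ d' : HasType Γ M' τ, d.den n = delay (tick τ n) k (d'.den n) := by
  -- Labels are arbitrary naturals in the type of `Step`, so the bound is proved alongside; the
  -- context rules then need only a single delay.
  have hk : k ≤ 1 → k = 0 ∨ k = 1 := by omega
  induction h generalizing τ with
  | beta σ M N =>
    cases d with
    | app d e =>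
      cases d with
      | lam d =>
        obtain ⟨d', h⟩ := d.inst_den (n := n) e
        exact ⟨by omega, d', (comp_curry_eval _ _).trans h.symm⟩
  | unfoldFold M =>
    cases d with
    | unfold d =>
      cases d with
      | fold d =>
        refine ⟨le_rfl, d, ?_⟩
        exact congrArg (fun g => Hom.comp (tick _ n) (Hom.comp g ((Hom.next _).comp (d.den n))))
          (muOut_muIn _ n)
  | caseInl L M N =>
    cases d with
    | case d d₁ d₂ =>
      cases d with
      | inl d =>
        obtain ⟨d', h⟩ := d₁.inst_den (n := n) d
        exact ⟨by omega, d', (extend_now _ _ _).trans h.symm⟩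
  | caseInr L M N =>
    cases d with
    | case d d₁ d₂ =>
      cases d with
      | inr d =>
        obtain ⟨d', h⟩ := d₂.inst_den (n := n) d
        exact ⟨by omega, d', (extend_now _ _ _).trans h.symm⟩
  | fstPair M N =>
    cases d with
    | fst d => cases d with
      | pair d e => exact ⟨by omega, d, rfl⟩
  | sndPair M N =>
    cases d with
    | snd d => cases d with
      | pair d e => exact ⟨by omega, e, rfl⟩
  | appCtx N h ih =>
    cases d with
    | app d e =>
      obtain ⟨hk', d', h⟩ := ih d hk
      refine ⟨hk', .app d' e, ?_⟩
      rw [HasType.den, h]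
      obtain rfl | rfl := hk hk'
      · rfl
      · rw [tick_arr]; exact eval_arr_delay _ _ _
  | caseCtx M N h ih =>
    cases d with
    | case d d₁ d₂ =>
      obtain ⟨hk', d', h⟩ := ih d hk
      refine ⟨hk', .case d' d₁ d₂, ?_⟩
      rw [HasType.den, h]
      obtain rfl | rfl := hk hk'
      · rfl
      · rw [tick_sum]; exact extend_delay _ _ _
  | fstCtx h ih =>
    cases d with
    | fst d =>
      obtain ⟨hk', d', h⟩ := ih d hk
      refine ⟨hk', .fst d', ?_⟩
      rw [HasType.den, h]
      obtain rfl | rfl := hk hk'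
      · rfl
      · rw [tick_prod]; exact prod_delay_fst _ _ _
  | sndCtx h ih =>
    cases d with
    | snd d =>
      obtain ⟨hk', d', h⟩ := ih d hk
      refine ⟨hk', .snd d', ?_⟩
      rw [HasType.den, h]
      obtain rfl | rfl := hk hk'
      · rfl
      · rw [tick_prod]; exact prod_delay_snd _ _ _
  | unfoldCtx h ih =>
    cases d with
    | unfold d =>
      obtain ⟨hk', d', h⟩ := ih d hk
      refine ⟨hk', .unfold d', ?_⟩
      rw [HasType.den, h]
      obtain rfl | rfl := hk hk'
      · rfl
      · exact unfold_delay _ _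

theorem Many.sound {M N : Tm} {k : ℕ} (h : Many M k N) (hk : k = 0) (n : ℕ) {Γ : List (Ty 0)}
    {τ : Ty 0} (d : HasType Γ M τ) : ∃ d' : HasType Γ N τ, d.den n = d'.den n := by
  induction h with
  | refl M => exact ⟨d, rfl⟩
  | @head M M' N k m h _ ih =>
    obtain ⟨rfl, rfl⟩ : k = 0 ∧ m = 0 := by omega
    obtain ⟨-, d', e⟩ := h.sound n d
    obtain ⟨d'', e'⟩ := ih rfl d'
    exact ⟨d'', e.trans e'⟩

/-- The element `(θ ∘ next)ᵏ (η *)` of `L 1`. -/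
def delayedUnit (k n : ℕ) : Hom (Psh.one n) (Psh.one n).lift :=
  delay (Alg.lift _) k (Hom.now _)

/-- The argument of θ lives one stage earlier, so information about the reduct that is only
available later suffices. At stage 0 nothing is left to compare under θ. -/
theorem Guarded.sound {n k : ℕ} {M : Tm} (d : HasType [] M .one) {m : ℕ} (h : m < n)
    (hM : Guarded k M .unit m) :
    (d.den n).app m h () = (delayedUnit k n).app m h () := by
  induction k generalizing M m with
  | zero =>
    obtain ⟨d', e⟩ := Many.sound hM rfl n d
    rw [e]
    -- The only derivation of `unit` is the axiom, whose denotation is η *.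
    cases d'
    rfl
  | succ k ih =>
    obtain ⟨M', M'', h₁, h₂, h₃⟩ := hM
    obtain ⟨d₁, e₁⟩ := h₁.sound rfl n d
    obtain ⟨-, d₂, e₂⟩ := h₂.sound n d₁
    rw [e₁, e₂, tick_one]
    refine congrArg ((Alg.lift (Psh.one n)).app m h) ?_
    cases m with
    | zero => rfl
    | succ m =>
      refine ((d₂.den n).nat m h ()).trans ((ih d₂ _ h₃).trans ?_)
      exact ((delayedUnit k n).nat m h ()).symm

/-! ### The logical relation -/

/-- The isomorphism `L A → A + ▷ (L A)`. -/
def liftOut {n : ℕ} (A : Psh n) :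
    (m : ℕ) → (h : m < n) → A.lift.obj m h → A.obj m h ⊕ A.lift.later.obj m h
  | 0, _ => id
  | _ + 1, _ => id

theorem liftOut_now {n : ℕ} (A : Psh n) (m : ℕ) (h : m < n) (a : A.obj m h) :
    liftOut A m h ((Hom.now A).app m h a) = Sum.inl a := by
  cases m <;> rfl

theorem liftOut_tick {n : ℕ} (A : Psh n) (m : ℕ) (h : m < n) (t : A.lift.later.obj m h) :
    liftOut A m h ((Alg.lift A).app m h t) = Sum.inr t := by
  cases m <;> rfl

theorem liftOut_res {n : ℕ} (A : Psh n) (m : ℕ) (h : m + 1 < n) (x : A.lift.obj (m + 1) h) :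
    liftOut A m (Nat.lt_of_succ_lt h) (A.lift.res m h x)
      = Sum.map (A.res m h) (A.lift.later.res m h) (liftOut A (m + 1) h x) := by
  obtain a | t := x <;> cases m <;> rfl

/-- `M` reduces, by `→⁰` steps and a final `→¹` step, to a term in `P`. -/
def StepsTo (M : Tm) (P : Tm → Prop) : Prop :=
  ∃ M' M'' : Tm, Many M 0 M' ∧ Step M' 1 M'' ∧ P M''

/-- The logical relation at stage `m`, by induction on types, from the relation `P` that is
available later. -/
def relStep {n m : ℕ} (h : m < n)
    (P : {k : ℕ} → (τ : Ty k) → (ρ : Fin k → Psh n) → k = 0 → (τ.den n ρ).later.obj m h →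
      Tm → Prop) :
    {k : ℕ} → (τ : Ty k) → (ρ : Fin k → Psh n) → k = 0 → (τ.den n ρ).obj m h → Tm → Prop
  | _, .var i, _, hk => (Fin.cast hk i).elim0
  | _, .one, ρ, hk => fun x M =>
      Sum.elim (fun _ => Many M 0 .unit) (fun t => StepsTo M (P .one ρ hk t))
        (liftOut (Psh.one n) m h x)
  | _, .sum σ τ, ρ, hk => fun x M =>
      Sum.elim (Sum.elim (fun y => ∃ L, Many M 0 (.inl L) ∧ relStep h P σ ρ hk y L)
          (fun y => ∃ L, Many M 0 (.inr L) ∧ relStep h P τ ρ hk y L))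
        (fun t => StepsTo M (P (.sum σ τ) ρ hk t))
        (liftOut ((σ.den n ρ).sum (τ.den n ρ)) m h x)
  | _, .prod σ τ, ρ, hk => fun x M =>
      relStep h P σ ρ hk x.1 (.fst M) ∧ relStep h P τ ρ hk x.2 (.snd M)
  | _, .arr σ τ, ρ, hk => fun f M =>
      -- This conjunct builds in stability under restriction; it replaces a quantification over all
      -- earlier stages in the next clause.
      P (.arr σ τ) ρ hk ((Hom.next _).app m h f) M ∧
      ∀ x N, relStep h P σ ρ hk x N →
        relStep h P τ ρ hk ((Hom.eval (σ.den n ρ) (τ.den n ρ)).app m h (f, x)) (.app M N)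
  | _, .mu τ, ρ, hk => fun x M =>
      -- The unrolled type may be larger, but `P` is the relation of the previous stage, so the
      -- recursion is well founded.
      StepsTo (.unfold M) (P τ.unroll ρ hk ((Hom.ofEq (Ty.den_mu τ n ρ)).app m h x))

/-- The logical relation, by guarded recursion. -/
def relRec {n : ℕ} : (m : ℕ) → (h : m < n) → {k : ℕ} → (τ : Ty k) → (ρ : Fin k → Psh n) → k = 0 →
    (τ.den n ρ).obj m h → Tm → Prop
  | 0, h => relStep h (fun _ _ _ _ _ => True)
  | m + 1, h => relStep h (fun τ ρ hk x M => relRec m (Nat.lt_of_succ_lt h) τ ρ hk x M)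

/-- The logical relation between interpretations of closed types and terms. -/
def Rel {n : ℕ} (m : ℕ) (h : m < n) (τ : Ty 0) (x : (τ.cden n).obj m h) (M : Tm) : Prop :=
  relRec m h τ _ rfl x M

/-- `▷ Rel`. -/
def LaterRel {n : ℕ} : (m : ℕ) → (h : m < n) → (τ : Ty 0) → (τ.cden n).later.obj m h → Tm → Prop
  | 0, _, _, _, _ => True
  | m + 1, h, τ, x, M => Rel m (Nat.lt_of_succ_lt h) τ x M

section

variable {n : ℕ} {m : ℕ} {h : m < n} {σ τ : Ty 0} {M : Tm}

theorem rel_one {x : (Ty.one.cden n).obj m h} :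
    Rel m h .one x M ↔
      Sum.elim (fun _ => Many M 0 .unit) (fun t => StepsTo M (LaterRel m h .one t))
        (liftOut (Psh.one n) m h x) := by
  cases m <;> rfl

theorem rel_sum {x : ((Ty.sum σ τ).cden n).obj m h} :
    Rel m h (.sum σ τ) x M ↔
      Sum.elim (Sum.elim (fun y => ∃ L, Many M 0 (.inl L) ∧ Rel m h σ y L)
          (fun y => ∃ L, Many M 0 (.inr L) ∧ Rel m h τ y L))
        (fun t => StepsTo M (LaterRel m h (.sum σ τ) t))
        (liftOut ((σ.cden n).sum (τ.cden n)) m h x) := by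
  cases m <;> rfl

theorem rel_prod {x : ((Ty.prod σ τ).cden n).obj m h} :
    Rel m h (.prod σ τ) x M ↔ Rel m h σ x.1 (.fst M) ∧ Rel m h τ x.2 (.snd M) := by
  cases m <;> rfl

theorem rel_arr {f : ((Ty.arr σ τ).cden n).obj m h} :
    Rel m h (.arr σ τ) f M ↔ LaterRel m h (.arr σ τ) ((Hom.next _).app m h f) M ∧
      ∀ x N, Rel m h σ x N →
        Rel m h τ ((Hom.eval (σ.cden n) (τ.cden n)).app m h (f, x)) (.app M N) := by
  cases m <;> rfl

theorem rel_mu {τ : Ty 1} {x : ((Ty.mu τ).cden n).obj m h} :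
    Rel m h (.mu τ) x M ↔ StepsTo (.unfold M) (LaterRel m h τ.unroll ((muOut τ n).app m h x)) := by
  cases m <;> rfl

end

/-! ### Closure properties of the logical relation -/

theorem StepsTo.mono {M : Tm} {P Q : Tm → Prop} (h : ∀ N, P N → Q N) : StepsTo M P → StepsTo M Q :=
  fun ⟨M', M'', h₁, h₂, h₃⟩ => ⟨M', M'', h₁, h₂, h _ h₃⟩

theorem Many.step {M M' N : Tm} (h : Step M 0 M') (h' : Many M' 0 N) : Many M 0 N :=
  Many.head h h'

theorem StepsTo.expand {M M' : Tm} {P : Tm → Prop} (h : Step M 0 M') :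
    StepsTo M' P → StepsTo M P :=
  fun ⟨N, N', h₁, h₂, h₃⟩ => ⟨N, N', h₁.step h, h₂, h₃⟩

/-- Evaluation contexts preserve reductions. -/
theorem Many.ctx {E : Tm → Tm} (hE : ∀ {M M' k}, Step M k M' → Step (E M) k (E M')) {M M' : Tm}
    {k : ℕ} (h : Many M k M') : Many (E M) k (E M') := by
  induction h with
  | refl M => exact .refl _
  | head h _ ih => exact .head (hE h) ih

theorem StepsTo.ctx {E : Tm → Tm} (hE : ∀ {M M' k}, Step M k M' → Step (E M) k (E M')) {M : Tm}
    {P Q : Tm → Prop} (hPQ : ∀ N, P N → Q (E N)) : StepsTo M P → StepsTo (E M) Q :=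
  fun ⟨M', M'', h₁, h₂, h₃⟩ => ⟨E M', E M'', h₁.ctx hE, hE h₂, hPQ _ h₃⟩

/-- The logical relation is a subobject: it is preserved by restriction to earlier stages. -/
theorem Rel.next {n : ℕ} (m : ℕ) (h : m < n) (τ : Ty 0) : ∀ (x : (τ.cden n).obj m h) (M : Tm),
    Rel m h τ x M → LaterRel m h τ ((Hom.next _).app m h x) M := by
  induction m generalizing τ with
  | zero => intros; trivial
  | succ m ihm =>
    -- The guarded parts of the clauses restrict by the induction on stages.
    have later : ∀ (τ : Ty 0) (t : (τ.cden n).later.obj (m + 1) h) (M : Tm),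
        LaterRel (m + 1) h τ t M →
        LaterRel m (Nat.lt_of_succ_lt h) τ ((τ.cden n).later.res m h t) M := by
      intro τ t M hM
      cases m <;> exact ihm _ τ t M hM
    change ∀ (x : (τ.cden n).obj (m + 1) h) (M : Tm),
      Rel (m + 1) h τ x M → Rel m (Nat.lt_of_succ_lt h) τ ((τ.cden n).res m h x) M
    induction τ using Ty.closed_induction with
    | one =>
      intro x M hM
      rw [rel_one] at hM ⊢
      erw [liftOut_res]
      generalize liftOut (Psh.one n) (m + 1) h x = y at hM
      obtain y | t := y
      · exact hM
      · exact hM.mono fun _ => later _ _ _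
    | sum σ τ ih₁ ih₂ =>
      intro x M hM
      rw [rel_sum] at hM ⊢
      erw [liftOut_res]
      generalize liftOut ((σ.cden n).sum (τ.cden n)) (m + 1) h x = y at hM
      obtain (y | y) | t := y
      · obtain ⟨L, h₁, h₂⟩ := hM
        exact ⟨L, h₁, ih₁ _ _ h₂⟩
      · obtain ⟨L, h₁, h₂⟩ := hM
        exact ⟨L, h₁, ih₂ _ _ h₂⟩
      · exact hM.mono fun _ => later _ _ _
    | prod σ τ ih₁ ih₂ =>
      intro x M hM
      rw [rel_prod] at hM ⊢
      exact ⟨ih₁ _ _ hM.1, ih₂ _ _ hM.2⟩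
    | arr σ τ _ _ =>
      intro x M hM
      exact (rel_arr.1 hM).1
    | mu τ =>
      intro x M hM
      rw [rel_mu] at hM ⊢
      rw [← (muOut τ n).nat]
      exact hM.mono fun _ => later _ _ _

theorem Rel.res {n : ℕ} {m : ℕ} {h : m + 1 < n} {τ : Ty 0} {x : (τ.cden n).obj (m + 1) h} {M : Tm}
    (hM : Rel (m + 1) h τ x M) : Rel m (Nat.lt_of_succ_lt h) τ ((τ.cden n).res m h x) M :=
  Rel.next _ _ _ _ _ hM

/-- Every clause either tests `M`, possibly inside an evaluation frame, by a reduction to which a →⁰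
step can be prepended, or passes to smaller types. Only the later conjunct at function types needs
the previous stage, hence the split into `step` and an outer induction. -/
theorem Rel.expand {n : ℕ} {m : ℕ} {h : m < n} {τ : Ty 0} {x : (τ.cden n).obj m h} {M M' : Tm}
    (hs : Step M 0 M') (hM : Rel m h τ x M') : Rel m h τ x M := by
  have step : ∀ (m : ℕ) (h : m < n), (∀ (τ : Ty 0) (x : (τ.cden n).later.obj m h) (M M' : Tm),
      Step M 0 M' → LaterRel m h τ x M' → LaterRel m h τ x M) →
      ∀ (τ : Ty 0) (x : (τ.cden n).obj m h) (M M' : Tm),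
        Step M 0 M' → Rel m h τ x M' → Rel m h τ x M := by
    intro m h hL τ
    induction τ using Ty.closed_induction with
    | one =>
      intro x M M' hs hM
      rw [rel_one] at hM ⊢
      generalize liftOut (Psh.one n) m h x = y at hM
      obtain y | t := y
      · exact Many.step hs hM
      · exact hM.expand hs
    | sum σ τ ih₁ ih₂ =>
      intro x M M' hs hM
      rw [rel_sum] at hM ⊢
      generalize liftOut ((σ.cden n).sum (τ.cden n)) m h x = y at hM
      obtain (y | y) | t := y
      · obtain ⟨L, h₁, h₂⟩ := hM
        exact ⟨L, h₁.step hs, h₂⟩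
      · obtain ⟨L, h₁, h₂⟩ := hM
        exact ⟨L, h₁.step hs, h₂⟩
      · exact hM.expand hs
    | prod σ τ ih₁ ih₂ =>
      intro x M M' hs hM
      rw [rel_prod] at hM ⊢
      exact ⟨ih₁ _ _ _ hs.fstCtx hM.1, ih₂ _ _ _ hs.sndCtx hM.2⟩
    | arr σ τ _ ih =>
      intro x M M' hs hM
      rw [rel_arr] at hM ⊢
      exact ⟨hL _ _ _ _ hs hM.1, fun y N hN => ih _ _ _ (hs.appCtx N) (hM.2 y N hN)⟩
    | mu τ =>
      intro x M M' hs hM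
      rw [rel_mu] at hM ⊢
      exact hM.expand hs.unfoldCtx
  induction m generalizing τ M M' with
  | zero => exact step 0 h (fun _ _ _ _ _ _ => trivial) _ _ _ _ hs hM
  | succ m ihm => exact step (m + 1) h (fun _ _ _ _ hs hM => ihm hs hM) _ _ _ _ hs hM

theorem Rel.expand_many {n : ℕ} {m : ℕ} {h : m < n} {τ : Ty 0} {x : (τ.cden n).obj m h}
    {M M' : Tm} {k : ℕ} (hs : Many M k M') (hk : k = 0) (hM : Rel m h τ x M') :
    Rel m h τ x M := by
  induction hs with
  | refl M => exact hM
  | @head M M' N k m h _ ih =>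
    obtain ⟨rfl, rfl⟩ : k = 0 ∧ m = 0 := by omega
    exact (ih rfl hM).expand h

theorem laterRel_next {n : ℕ} {m : ℕ} {h : m < n} {τ : Ty 0} {x : (τ.cden n).obj m h} {M : Tm}
    (hM : Rel m h τ x M) : LaterRel m h τ ((Hom.next _).app m h x) M :=
  Rel.next _ _ _ _ _ hM

/-- The logical relation is closed under `θ`. -/
theorem Rel.tick {n : ℕ} {m : ℕ} {h : m < n} {τ : Ty 0} {t : (τ.cden n).later.obj m h} {M : Tm}
    (hM : StepsTo M (LaterRel m h τ t)) : Rel m h τ ((tick τ n).app m h t) M := by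
  induction m using Nat.strong_induction_on generalizing τ M with | _ m ihm => ?_
  induction τ using Ty.closed_induction generalizing M with
  | one =>
    rw [rel_one, tick_one]
    erw [liftOut_tick]
    exact hM
  | sum σ τ _ _ =>
    rw [rel_sum, tick_sum]
    erw [liftOut_tick]
    exact hM
  | prod σ τ ih₁ ih₂ =>
    rw [rel_prod, tick_prod]
    constructor
    · refine ih₁ (hM.ctx .fstCtx fun N hN => ?_)
      cases m with
      | zero => trivial
      | succ m => exact (rel_prod.1 hN).1
    · refine ih₂ (hM.ctx .sndCtx fun N hN => ?_)
      cases m with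
      | zero => trivial
      | succ m => exact (rel_prod.1 hN).2
  | arr σ τ _ ih =>
    rw [rel_arr]
    constructor
    · cases m with
      | zero => trivial
      | succ m =>
        -- Naturality turns the restriction of θ t into θ of the restricted t, where the induction
        -- hypothesis on stages applies.
        have e := (FPC.tick (.arr σ τ) n).nat m h t
        change Rel m _ _ (((Ty.arr σ τ).cden n).res m h _) M
        rw [e]
        refine ihm m (Nat.lt_succ_self m) (hM.mono fun N hN => ?_)
        have := laterRel_next hN
        cases m <;> exact this
    · intro x N hN
      rw [tick_arr]
      have e := Psh.resTo_self ((σ.cden n).arr (τ.cden n)).later h t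
      change Rel m h τ ((FPC.tick τ n).app m h ((Hom.laterAp _ _).app m h
        (((σ.cden n).arr (τ.cden n)).later.resTo h le_rfl h t, (Hom.next _).app m h x))) _
      rw [e]
      refine ih (hM.ctx (E := fun M => .app M N) (.appCtx N) fun L hL => ?_)
      cases m with
      | zero => trivial
      -- The pointwise θ applies t to `next x`, so the argument is needed one stage earlier.
      | succ m => exact (rel_arr.1 hL).2 _ _ hN.res
  | mu τ =>
    rw [rel_mu]
    -- Under ▷, θ at `μ` becomes θ of the unrolling at the previous stage. The induction on stages
    -- therefore has to cover all types.
    have e := congrArg (fun f => Hom.app f m h t) (muOut_tick τ n)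
    change (muOut τ n).app m h _ = _ at e
    rw [e]
    refine hM.ctx .unfoldCtx fun N hN => ?_
    cases m with
    | zero => trivial
    | succ m => exact ihm m (Nat.lt_succ_self m) (rel_mu.1 hN)

/-! ### The fundamental lemma and computational adequacy -/

/-- The logical relation between interpretations of contexts and substitutions. -/
def EnvRel {n : ℕ} (m : ℕ) (h : m < n) (Γ : List (Ty 0)) (g : (ctxDen Γ n).obj m h)
    (s : ℕ → Tm) : Prop :=
  ∀ (i : ℕ) (σ : Ty 0) (l : Lookup Γ i σ), Rel m h σ ((l.den n).app m h g) (s i)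

theorem EnvRel.res {n m : ℕ} {h : m + 1 < n} {Γ : List (Ty 0)}
    {g : (ctxDen Γ n).obj (m + 1) h} {s : ℕ → Tm} (hg : EnvRel (m + 1) h Γ g s) :
    EnvRel m (Nat.lt_of_succ_lt h) Γ ((ctxDen Γ n).res m h g) s := by
  intro i σ l
  rw [← (l.den n).nat]
  exact (hg i σ l).res

theorem EnvRel.cons {n m : ℕ} {h : m < n} {Γ : List (Ty 0)} {g : (ctxDen Γ n).obj m h}
    {s : ℕ → Tm} (hg : EnvRel m h Γ g s) {σ : Ty 0} {x : (σ.cden n).obj m h} {N : Tm}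
    (hx : Rel m h σ x N) : EnvRel m h (σ :: Γ) (g, x) (Tm.cons N s) := by
  intro i τ l
  cases l with
  | zero => exact hx
  | succ l => exact hg _ _ l

/-- The application clause is a β-expansion at each stage; induction on the stage serves the later
conjunct of the function clause. -/
theorem Rel.curry {n : ℕ} {Γ : List (Ty 0)} {σ τ : Ty 0} {f : Hom (ctxDen (σ :: Γ) n) (τ.cden n)}
    {M : Tm} (hf : ∀ (m : ℕ) (h : m < n) (g : (ctxDen (σ :: Γ) n).obj m h) (s : ℕ → Tm),
      EnvRel m h (σ :: Γ) g s → Rel m h τ (f.app m h g) (M.subst s))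
    (m : ℕ) (h : m < n) (g : (ctxDen Γ n).obj m h) (s : ℕ → Tm) (hg : EnvRel m h Γ g s) :
    Rel m h (.arr σ τ) ((Hom.curry f).app m h g) (.lam σ (M.subst (Tm.ups s))) := by
  have app : ∀ (m : ℕ) (h : m < n) (g : (ctxDen Γ n).obj m h), EnvRel m h Γ g s → ∀ x N,
      Rel m h σ x N → Rel m h τ ((Hom.eval (σ.cden n) (τ.cden n)).app m h
        ((Hom.curry f).app m h g, x)) (.app (.lam σ (M.subst (Tm.ups s))) N) := by
    intro m h g hg x N hN
    refine .expand (.beta _ _ _) ?_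
    rw [Tm.inst_subst_ups]
    have e : f.app m h ((ctxDen Γ n).resTo h le_rfl h g, x) = f.app m h (g, x) := by
      rw [Psh.resTo_self]
    change Rel m h τ (f.app m h ((ctxDen Γ n).resTo h le_rfl h g, x)) _
    rw [e]
    exact hf m h _ _ (hg.cons hN)
  induction m with
  | zero => exact rel_arr.2 ⟨trivial, app _ _ _ hg⟩
  | succ m ih =>
    refine rel_arr.2 ⟨?_, app _ _ _ hg⟩
    change Rel m _ _ (((Ty.arr σ τ).cden n).res m h _) _
    have e := (Hom.curry f).nat m h g
    exact e ▸ ih _ _ hg.res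

/-- The induction follows the recursion of `extendApp`. If the semantic scrutinee is a value, the
term reduces to an injection inside `E`, and expansion applies; if it is delayed, `Rel.tick` reduces
the claim to the previous stage. -/
theorem Rel.extend {n : ℕ} {Γ : List (Ty 0)} {τ₁ τ₂ σ : Ty 0}
    {f : Hom ((ctxDen Γ n).prod ((τ₁.cden n).sum (τ₂.cden n))) (σ.cden n)} {s : ℕ → Tm}
    {E : Tm → Tm} (hE : ∀ {M M' k}, Step M k M' → Step (E M) k (E M'))
    (h₁ : ∀ (m : ℕ) (h : m < n) (g : (ctxDen Γ n).obj m h) (x : (τ₁.cden n).obj m h) (L : Tm),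
      EnvRel m h Γ g s → Rel m h τ₁ x L → Rel m h σ (f.app m h (g, Sum.inl x)) (E (.inl L)))
    (h₂ : ∀ (m : ℕ) (h : m < n) (g : (ctxDen Γ n).obj m h) (x : (τ₂.cden n).obj m h) (L : Tm),
      EnvRel m h Γ g s → Rel m h τ₂ x L → Rel m h σ (f.app m h (g, Sum.inr x)) (E (.inr L)))
    (m : ℕ) (h : m < n) (g : (ctxDen Γ n).obj m h) (x : ((Ty.sum τ₁ τ₂).cden n).obj m h) (L : Tm)
    (hg : EnvRel m h Γ g s) (hL : Rel m h (.sum τ₁ τ₂) x L) :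
    Rel m h σ (extendApp (FPC.tick σ n) f m h g x) (E L) := by
  induction m generalizing L with
  | zero =>
    replace hL := rel_sum.1 hL
    obtain (y | y) | t := x
    · obtain ⟨L', e, hL'⟩ := hL
      exact (h₁ _ _ _ _ _ hg hL').expand_many (e.ctx hE) rfl
    · obtain ⟨L', e, hL'⟩ := hL
      exact (h₂ _ _ _ _ _ hg hL').expand_many (e.ctx hE) rfl
    · exact Rel.tick (StepsTo.ctx hE (fun _ _ => trivial) hL)
  | succ m ih =>
    replace hL := rel_sum.1 hL
    obtain (y | y) | t := x
    · obtain ⟨L', e, hL'⟩ := hL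
      exact (h₁ _ _ _ _ _ hg hL').expand_many (e.ctx hE) rfl
    · obtain ⟨L', e, hL'⟩ := hL
      exact (h₂ _ _ _ _ _ hg hL').expand_many (e.ctx hE) rfl
    · exact Rel.tick (h := h) (StepsTo.ctx hE (fun _ hN => ih _ _ _ _ hg.res hN) hL)

/-- The fundamental lemma of the logical relation. -/
theorem HasType.rel {n : ℕ} {Γ : List (Ty 0)} {M : Tm} {τ : Ty 0} (d : HasType Γ M τ) (m : ℕ)
    (h : m < n) (g : (ctxDen Γ n).obj m h) (s : ℕ → Tm) (hg : EnvRel m h Γ g s) :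
    Rel m h τ ((d.den n).app m h g) (M.subst s) := by
  induction d generalizing m s with
  | var l => exact hg _ _ l
  | unit =>
    rw [rel_one]
    erw [liftOut_now]
    exact Many.refl _
  | lam d ih => exact Rel.curry ih m h g s hg
  | app d e ih₁ ih₂ => exact (rel_arr.1 (ih₁ m h g s hg)).2 _ _ (ih₂ m h g s hg)
  | inl d ih =>
    rw [rel_sum]
    erw [liftOut_now]
    exact ⟨_, .refl _, ih m h g s hg⟩
  | inr d ih =>
    rw [rel_sum]
    erw [liftOut_now]
    exact ⟨_, .refl _, ih m h g s hg⟩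
  | @case _ _ M N _ _ _ d d₁ d₂ ih ih₁ ih₂ =>
    refine Rel.extend (s := s) (E := fun L => .case L (M.subst (Tm.ups s)) (N.subst (Tm.ups s)))
      (.caseCtx _ _) ?_ ?_ m h g _ _ hg (ih m h g s hg)
    · intro m h g x L hg hL
      refine .expand (.caseInl _ _ _) ?_
      rw [Tm.inst_subst_ups]
      exact ih₁ m h (g, x) _ (hg.cons hL)
    · intro m h g x L hg hL
      refine .expand (.caseInr _ _ _) ?_
      rw [Tm.inst_subst_ups]
      exact ih₂ m h (g, x) _ (hg.cons hL)
  | fst d ih => exact (rel_prod.1 (ih m h g s hg)).1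
  | snd d ih => exact (rel_prod.1 (ih m h g s hg)).2
  | pair d e ih₁ ih₂ =>
    exact rel_prod.2 ⟨(ih₁ m h g s hg).expand (.fstPair _ _),
      (ih₂ m h g s hg).expand (.sndPair _ _)⟩
  | unfold d ih => exact Rel.tick (rel_mu.1 (ih m h g s hg))
  | @fold _ _ τ d ih =>
    -- Unfolding the fold takes exactly one →¹ step, back to the folded term.
    refine rel_mu.2 ⟨_, _, .refl _, .unfoldFold _, ?_⟩
    have e := congrArg (fun f => Hom.app f m h ((Hom.next _).app m h ((d.den n).app m h g)))
      (muOut_muIn τ n)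
    exact e ▸ laterRel_next (ih m h g s hg)

/-- Each θ ∘ next selects the guarded clause at type 1, which is the successor clause of `Guarded`;
the final η selects the zero clause. -/
theorem Rel.guarded {n k m : ℕ} {h : m < n} {M : Tm}
    (hM : Rel m h .one ((delayedUnit k n).app m h ()) M) : Guarded k M .unit m := by
  induction k generalizing m M with
  | zero =>
    replace hM := rel_one.1 hM
    erw [liftOut_now] at hM
    exact hM
  | succ k ih =>
    replace hM := rel_one.1 hM
    erw [liftOut_tick] at hM
    obtain ⟨M', M'', h₁, h₂, h₃⟩ := hM
    refine ⟨M', M'', h₁, h₂, ?_⟩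
    cases m with
    | zero => trivial
    | succ m =>
      have e := (delayedUnit k n).nat m h ()
      exact ih (h := Nat.lt_of_succ_lt h) (e ▸ h₃)

/-- Computational adequacy. -/
theorem Guarded.adequacy {n k m : ℕ} {M : Tm} (d : HasType [] M .one) (h : m < n)
    (hM : (d.den n).app m h () = (delayedUnit k n).app m h ()) : Guarded k M .unit m := by
  -- In the empty context every substitution is related, so the identity may be taken.
  have hd := d.rel m h () Tm.var (fun _ _ l => nomatch l)
  rw [Tm.subst_var] at hd
  exact (hM ▸ hd).guarded

/-! ### Contexts -/

/-- A term equivalent to `P` whose typings give the variables `i, i + 1, …` the types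
listed in `Γ`. -/
def pinVars : List (Ty 0) → ℕ → Tm → Tm
  | [], _, P => P
  -- The annotated identity forces variable `i` to have type `σ`; the projection discards it.
  | σ :: Γ, i, P => .fst (.pair (pinVars Γ (i + 1) P) (.app (.lam σ (.var 0)) (.var i)))

theorem pinVars_hasType {Δ : List (Ty 0)} {P : Tm} {τ : Ty 0} (d : HasType Δ P τ)
    (Γ : List (Ty 0)) (i : ℕ)
    (hl : ∀ j σ, Lookup Γ j σ → Nonempty (Lookup Δ (i + j) σ)) :
    Nonempty (HasType Δ (pinVars Γ i P) τ) := by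
  induction Γ generalizing i with
  | nil => exact ⟨d⟩
  | cons σ Γ ih =>
    obtain ⟨d'⟩ := ih (i + 1) fun j σ l => by
      have := hl _ _ (.succ l)
      rwa [← Nat.add_assoc, Nat.add_right_comm] at this
    obtain ⟨l⟩ := hl _ _ .zero
    exact ⟨.fst (.pair d' (.app (.lam (.var .zero)) (.var l)))⟩

theorem pinVars_inversion {Δ : List (Ty 0)} {P : Tm} {τ : Ty 0} {r : ℕ → ℕ}
    (Γ : List (Ty 0)) (i : ℕ) (d : HasType Δ ((pinVars Γ i P).rename r) τ) :
    Nonempty (HasType Δ (P.rename r) τ) ∧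
      ∀ j σ, Lookup Γ j σ → Nonempty (Lookup Δ (r (i + j)) σ) := by
  induction Γ generalizing i with
  | nil => exact ⟨⟨d⟩, fun _ _ l => nomatch l⟩
  | cons σ Γ ih =>
    change HasType Δ (.fst (.pair ((pinVars Γ (i + 1) P).rename r)
      (.app (.lam σ (.var 0)) (.var (r i))))) τ at d
    -- The eighth constructor, `fst`, is the only one that types this term.
    obtain _ | _ | _ | _ | _ | _ | _ | d := d
    cases d with
    | pair d e =>
      obtain ⟨hd, hl⟩ := ih _ d
      refine ⟨hd, fun j ρ l => ?_⟩
      cases l with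
      | zero =>
        cases e with
        | app e₁ e₂ => cases e₁; cases e₂ with
          | var l => exact ⟨l⟩
      | @succ _ j _ _ l =>
        have := hl _ _ l
        rwa [Nat.add_right_comm] at this

theorem exists_renamesTo (n : ℕ) {Γ Δ : List (Ty 0)} {r : ℕ → ℕ}
    (hl : ∀ j σ, Lookup Γ j σ → Nonempty (Lookup Δ (r j) σ)) : ∃ f, RenamesTo n Γ Δ r f := by
  induction Γ generalizing r with
  | nil => exact ⟨⟨fun _ _ _ => (), fun _ _ _ => rfl⟩, fun _ _ l => nomatch l⟩
  | cons σ Γ ih =>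
    obtain ⟨f, hf⟩ := ih (r := fun i => r (i + 1)) fun j τ l => hl _ _ (.succ l)
    obtain ⟨l₀⟩ := hl _ _ .zero
    refine ⟨Hom.pair f (l₀.den n), fun i τ l => ?_⟩
    cases l with
    | zero => exact ⟨l₀, rfl⟩
    | succ l => exact hf _ _ l

/-- Terms all of whose renamed copies have type `τ`, in contexts that extend `Γ`. -/
def Pins (P : Tm) (Γ : List (Ty 0)) (τ : Ty 0) : Prop :=
  ∀ (Δ : List (Ty 0)) (r : ℕ → ℕ) (σ : Ty 0), HasType Δ (P.rename r) σ →
    σ = τ ∧ ∀ j ρ, Lookup Γ j ρ → Nonempty (Lookup Δ (r j) ρ)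

/-- A derivation of C[M] may type the hole differently: a summand of an injection is free, and
variables that M does not use are unconstrained. An annotated identity around M fixes the type, and
`pinVars` fixes the variables. -/
theorem exists_pins {Γ : List (Ty 0)} {M : Tm} {τ : Ty 0} (d : HasType Γ M τ) :
    ∃ P, Nonempty (HasType Γ P τ) ∧ Pins P Γ τ := by
  refine ⟨pinVars Γ 0 (.app (.lam τ (.var 0)) M),
    pinVars_hasType (.app (.lam (.var .zero)) d) Γ 0 fun j σ l => ⟨(Nat.zero_add j).symm ▸ l⟩, ?_⟩
  intro Δ r σ d
  obtain ⟨⟨d⟩, hl⟩ := pinVars_inversion Γ 0 d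
  refine ⟨?_, fun j ρ l => Nat.zero_add j ▸ hl j ρ l⟩
  change HasType Δ (.app (.lam τ (.var 0)) (M.rename r)) σ at d
  cases d with
  | app d _ => cases d with
    | lam d => cases d with
      | var l => cases l; rfl

/-- Contexts preserve equality of denotations. -/
theorem Cx.den_congr {n : ℕ} {Γ : List (Ty 0)} {τ : Ty 0} {M N P : Tm} (dM : HasType Γ M τ)
    (dN : HasType Γ N τ) (hden : dM.den n = dN.den n) (hP : Pins P Γ τ) (C : Cx)
    {Δ : List (Ty 0)} {σ : Ty 0} (d : HasType Δ (C.fill P) σ) :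
    ∃ (d₁ : HasType Δ (C.fill M) σ) (d₂ : HasType Δ (C.fill N) σ), d₁.den n = d₂.den n := by
  induction C generalizing Δ σ with
  | hole r =>
    -- Pinning makes the type at the hole `τ` and embeds `Γ` into `Δ` along `r`, so one and the same
    -- map `f` interprets the renaming of both terms.
    obtain ⟨rfl, hl⟩ := hP Δ r σ d
    obtain ⟨f, hf⟩ := exists_renamesTo n hl
    obtain ⟨d₁, e₁⟩ := dM.rename_den hf
    obtain ⟨d₂, e₂⟩ := dN.rename_den hf
    exact ⟨d₁, d₂, e₁.trans ((congrArg (fun g => Hom.comp g f) hden).trans e₂.symm)⟩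
  | lam ρ C ih =>
    cases d with
    | lam d =>
      obtain ⟨d₁, d₂, e⟩ := ih d
      exact ⟨.lam d₁, .lam d₂, congrArg Hom.curry e⟩
  | appL C L ih =>
    cases d with
    | app d d' =>
      obtain ⟨d₁, d₂, e⟩ := ih d
      exact ⟨.app d₁ d', .app d₂ d',
        congrArg (fun f => (Hom.eval _ _).comp (Hom.pair f (d'.den n))) e⟩
  | appR L C ih =>
    cases d with
    | app d' d =>
      obtain ⟨d₁, d₂, e⟩ := ih d
      exact ⟨.app d' d₁, .app d' d₂,
        congrArg (fun f => (Hom.eval _ _).comp (Hom.pair (d'.den n) f)) e⟩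
  | inl C ih =>
    cases d with
    | @inl _ _ σ τ d =>
      obtain ⟨d₁, d₂, e⟩ := ih d
      exact ⟨.inl d₁, .inl d₂,
        congrArg (fun f => (Hom.now _).comp ((Hom.inl (σ.cden n) (τ.cden n)).comp f)) e⟩
  | inr C ih =>
    cases d with
    | @inr _ _ σ τ d =>
      obtain ⟨d₁, d₂, e⟩ := ih d
      exact ⟨.inr d₁, .inr d₂,
        congrArg (fun f => (Hom.now _).comp ((Hom.inr (σ.cden n) (τ.cden n)).comp f)) e⟩
  | pairL C L ih =>
    cases d with
    | pair d d' =>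
      obtain ⟨d₁, d₂, e⟩ := ih d
      exact ⟨.pair d₁ d', .pair d₂ d', congrArg (fun f => Hom.pair f (d'.den n)) e⟩
  | pairR L C ih =>
    cases d with
    | pair d' d =>
      obtain ⟨d₁, d₂, e⟩ := ih d
      exact ⟨.pair d' d₁, .pair d' d₂, congrArg (Hom.pair (d'.den n)) e⟩
  | fst C ih =>
    cases d with
    | @fst _ _ _ ρ d =>
      obtain ⟨d₁, d₂, e⟩ := ih d
      exact ⟨.fst d₁, .fst d₂, congrArg (Hom.comp (Hom.fst (σ.cden n) (ρ.cden n))) e⟩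
  | snd C ih =>
    cases d with
    | @snd _ _ ρ _ d =>
      obtain ⟨d₁, d₂, e⟩ := ih d
      exact ⟨.snd d₁, .snd d₂, congrArg (Hom.comp (Hom.snd (ρ.cden n) (σ.cden n))) e⟩
  | caseS C L L' ih =>
    cases d with
    | case d d' d'' =>
      obtain ⟨d₁, d₂, e⟩ := ih d
      exact ⟨.case d₁ d' d'', .case d₂ d' d'', congrArg (fun f =>
        (Hom.extend (tick σ n) (Hom.copair (d'.den n) (d''.den n))).comp (Hom.pair (Hom.id _) f)) e⟩
  | caseL L C L' ih =>
    cases d with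
    | case d' d d'' =>
      obtain ⟨d₁, d₂, e⟩ := ih d
      exact ⟨.case d' d₁ d'', .case d' d₂ d'', congrArg (fun f =>
        (Hom.extend (tick σ n) (Hom.copair f (d''.den n))).comp
          (Hom.pair (Hom.id _) (d'.den n))) e⟩
  | caseR L L' C ih =>
    cases d with
    | case d' d'' d =>
      obtain ⟨d₁, d₂, e⟩ := ih d
      exact ⟨.case d' d'' d₁, .case d' d'' d₂, congrArg (fun f =>
        (Hom.extend (tick σ n) (Hom.copair (d''.den n) f)).comp
          (Hom.pair (Hom.id _) (d'.den n))) e⟩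
  | unfold C ih =>
    cases d with
    | @unfold _ _ τ d =>
      obtain ⟨d₁, d₂, e⟩ := ih d
      exact ⟨.unfold d₁, .unfold d₂,
        congrArg (fun f => (tick τ.unroll n).comp ((muOut τ n).comp f)) e⟩
  | fold C ih =>
    cases d with
    | @fold _ _ τ d =>
      obtain ⟨d₁, d₂, e⟩ := ih d
      exact ⟨.fold d₁, .fold d₂, congrArg (fun f => (muIn τ n).comp ((Hom.next _).comp f)) e⟩

end FPC

theorem mainTheorem7 (Γ : List (FPC.Ty 0)) (τ : FPC.Ty 0) (M N : FPC.Tm)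
    (dM : FPC.HasType Γ M τ) (dN : FPC.HasType Γ N τ)
    (C : FPC.Cx) (hC : C.HasCxType Γ τ [] FPC.Ty.one) (k n : ℕ)
    (hden : dM.den (n + 1) = dN.den (n + 1))
    (hM : FPC.Guarded k (C.fill M) FPC.Tm.unit n) :
    FPC.Guarded k (C.fill N) FPC.Tm.unit n := by
  obtain ⟨P, hP, hpins⟩ := FPC.exists_pins dM
  obtain ⟨d⟩ := hC P hP
  obtain ⟨d₁, d₂, e⟩ := C.den_congr dM dN hden hpins d
  -- Stage `n` is the last stage of height `n + 1`.
  refine FPC.Guarded.adequacy d₂ (Nat.lt_succ_self n) ?_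
  rw [← e]
  exact hM.sound d₁ _
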